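/- Theorem. Let $V$ be a real vector space of dimension $2n$, $\Lambda\subset V$ a lattice, and $\omega$ a constant symplectic form on $V$ which takes rational values on $\Lambda\times\Lambda$ (so that $(V/\Lambda,\omega)$ is a rational symplectic torus). Let $\mathcal U(V)$ be the set of complex-valued alternating $n$-forms $\Omega$ on $V$ which are primitive ($\Omega\wedge\omega=0$) and have non-zero pullback to every Lagrangian subspace of $V$, and let $\mathcal U_{\mathrm{geom}}(V)\subset\mathcal U(V)$ be the subset of those which are of type $(n,0)$ for some linear complex structure $J$ compatible with $\omega$ (i.e. $\omega(Jx,Jy)=\omega(x,y)$ and $\omega(x,Jx)>0$ for $x\neq 0$). Regard $\Omega\in\mathcal U_{\mathrm{geom}}(V)$ as a constant form on $V/\Lambda$, and put $$\mathrm{Vol}_\Omega(V/\Lambda)=\int_{V/\Lambda}(-1)^{n(n-1)/2}\left(\tfrac{i}{2}\right)^n\Omega\wedge\overline{\Omega},$$ where the torus is oriented by $\omega^n$, and $$\mathrm{Sys}_\Omega(V/\Lambda)=\inf\left\{\int_L|\Omega| \;:\; L\subset V/\Lambda\text{ a non-empty compact special Lagrangian submanifold}\right\},$$ where a Lagrangian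 submanifold $L$ is called special if $\mathrm{Arg}(\Omega|_L)\in\mathbb R/\pi\mathbb Z$ is constant on $L$. Then there is a constant $C>0$, depending only on $(V/\Lambda,\omega)$, such that for every $\Omega\in\mathcal U_{\mathrm{geom}}(V)$ the systole $\mathrm{Sys}_\Omega(V/\Lambda)$ is finite and $$\left(\mathrm{Sys}_\Omega(V/\Lambda)\right)^2\leq C\,\mathrm{Vol}_\Omega(V/\Lambda).$$ -/

import Mathlib

open scoped ENNReal

namespace SympTorus

/-! ### Exterior algebra of constant forms -/

section Forms

variable {V : Type*} [AddCommGroup V] [Module ℝ V]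

/-- The exterior product of a `k`-form and an `l`-form with values in a commutative real algebra
(the sum over `(k, l)`-shuffles, without further normalisation). -/
noncomputable def wedge {A : Type*} [CommRing A] [Algebra ℝ A] {k l : ℕ}
    (α : V [⋀^Fin k]→ₗ[ℝ] A) (β : V [⋀^Fin l]→ₗ[ℝ] A) : V [⋀^Fin (k + l)]→ₗ[ℝ] A :=
  ((LinearMap.mul' ℝ A).compAlternatingMap (α.domCoprod β)).domDomCongr finSumFinEquiv

/-- A real form regarded as a complex-valued form. -/
noncomputable def complexify {k : ℕ} (α : V [⋀^Fin k]→ₗ[ℝ] ℝ) : V [⋀^Fin k]→ₗ[ℝ] ℂ :=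
  (Algebra.linearMap ℝ ℂ).compAlternatingMap α

/-- The complex conjugate of a complex-valued form. -/
noncomputable def conjForm {k : ℕ} (α : V [⋀^Fin k]→ₗ[ℝ] ℂ) : V [⋀^Fin k]→ₗ[ℝ] ℂ :=
  Complex.conjAe.toLinearMap.compAlternatingMap α

/-- The `k`-fold exterior power `ω ∧ ⋯ ∧ ω` of a two-form. -/
noncomputable def wedgePow (ω : V [⋀^Fin 2]→ₗ[ℝ] ℝ) : (k : ℕ) → V [⋀^Fin (2 * k)]→ₗ[ℝ] ℝ
  | 0 => (AlternatingMap.constOfIsEmpty ℝ V (Fin 0) 1 : V [⋀^Fin 0]→ₗ[ℝ] ℝ)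
  | k + 1 => wedge (wedgePow ω k) ω

/-- The symplectic volume form `ωⁿ / n!`. -/
noncomputable def dVolSymp (n : ℕ) (ω : V [⋀^Fin 2]→ₗ[ℝ] ℝ) : V [⋀^Fin (2 * n)]→ₗ[ℝ] ℝ :=
  ((n.factorial : ℝ)⁻¹) • wedgePow ω n

/-- The top-degree form `(-1)^(n(n-1)/2) (i/2)ⁿ Ω ∧ Ω̄`. -/
noncomputable def dVolForm {n : ℕ} (Ω : V [⋀^Fin n]→ₗ[ℝ] ℂ) : V [⋀^Fin (2 * n)]→ₗ[ℝ] ℂ :=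
  ((-1 : ℂ) ^ (n * (n - 1) / 2) * (Complex.I / 2) ^ n) •
    (wedge Ω (conjForm Ω)).domDomCongr (finCongr (two_mul n).symm)

/-! ### Symplectic linear algebra -/

/-- A two-form is symplectic if it is nondegenerate. -/
def IsSymplectic (ω : V [⋀^Fin 2]→ₗ[ℝ] ℝ) : Prop :=
  ∀ x : V, x ≠ 0 → ∃ y : V, ω ![x, y] ≠ 0

/-- A subspace is Lagrangian if it is its own `ω`-orthogonal complement. -/
def IsLagrangian (ω : V [⋀^Fin 2]→ₗ[ℝ] ℝ) (L : Submodule ℝ V) : Prop :=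
  ∀ x : V, x ∈ L ↔ ∀ y ∈ L, ω ![x, y] = 0

/-- The linear complex structure `J` is compatible with `ω`: it preserves `ω` and `ω(x, Jx) > 0`
for all `x ≠ 0`. -/
structure IsCompatible (ω : V [⋀^Fin 2]→ₗ[ℝ] ℝ) (J : V →ₗ[ℝ] V) : Prop where
  sq : ∀ x, J (J x) = -x
  invariant : ∀ x y, ω ![J x, J y] = ω ![x, y]
  pos : ∀ x, x ≠ 0 → 0 < ω ![x, J x]

/-- A complex-valued `n`-form on a `2n`-dimensional space is of type `(n,0)` with respect to `J`
if it is complex multilinear for the complex structure `J`. -/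
def IsTypeTop {n : ℕ} (J : V →ₗ[ℝ] V) (Ω : V [⋀^Fin n]→ₗ[ℝ] ℂ) : Prop :=
  ∀ (v : Fin n → V) (i : Fin n), Ω (Function.update v i (J (v i))) = Complex.I * Ω v

/-- The set `𝒰(V)` of primitive complex-valued `n`-forms (`Ω ∧ ω = 0`) on the `2n`-dimensional
symplectic space `V` whose pullback to every Lagrangian subspace is non-zero. -/
def nonvanishingForms (n : ℕ) (ω : V [⋀^Fin 2]→ₗ[ℝ] ℝ) : Set (V [⋀^Fin n]→ₗ[ℝ] ℂ) :=
  {Ω | wedge Ω (complexify ω) = 0 ∧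
    ∀ L : Submodule ℝ V, IsLagrangian ω L → Ω.compLinearMap L.subtype ≠ 0}

/-- The set `𝒰_geom(V)` of those forms in `𝒰(V)` which are of type `(n,0)` with respect to some
compatible complex structure. -/
def geometricForms (n : ℕ) (ω : V [⋀^Fin 2]→ₗ[ℝ] ℝ) : Set (V [⋀^Fin n]→ₗ[ℝ] ℂ) :=
  {Ω | Ω ∈ nonvanishingForms n ω ∧ ∃ J : V →ₗ[ℝ] V, IsCompatible ω J ∧ IsTypeTop J Ω}

/-- The symplectic form takes rational values on the lattice. -/
def IsRationalOn (ω : V [⋀^Fin 2]→ₗ[ℝ] ℝ) (Λ : Submodule ℤ V) : Prop :=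
  ∀ x ∈ Λ, ∀ y ∈ Λ, ∃ q : ℚ, ω ![x, y] = (q : ℝ)

open Classical in
/-- The integral over the torus `V/Λ`, oriented by `ωⁿ`, of a constant top-degree form `α`. If `b`
is a positively oriented `ℤ`-basis of `Λ`, then `u ↦ ∑ uᵢ bᵢ` parametrises `V/Λ` by the unit cube,
on which `α` pulls back to the constant form `α(b₁, …, b₂ₙ) du₁ ∧ ⋯ ∧ du₂ₙ`. -/
noncomputable def torusIntegral (n : ℕ) (ω : V [⋀^Fin 2]→ₗ[ℝ] ℝ) (Λ : Submodule ℤ V)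
    (α : V [⋀^Fin (2 * n)]→ₗ[ℝ] ℂ) : ℂ :=
  if h : ∃ b : Module.Basis (Fin (2 * n)) ℤ Λ, 0 < dVolSymp n ω (fun i => (b i : V)) then
    α (fun i => (h.choose i : V))
  else 0

/-- The volume `Vol_Ω(V/Λ)`, the integral of `(-1)^(n(n-1)/2) (i/2)ⁿ Ω ∧ Ω̄` over the torus. This
form is real, so passing to the real part only changes the type of the value. -/
noncomputable def Vol {n : ℕ} (ω : V [⋀^Fin 2]→ₗ[ℝ] ℝ) (Λ : Submodule ℤ V)
    (Ω : V [⋀^Fin n]→ₗ[ℝ] ℂ) : ℝ :=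
  (torusIntegral n ω Λ (dVolForm Ω)).re

end Forms

/-! ### Special Lagrangian submanifolds of the torus -/

section Submanifolds

variable {V : Type*} [NormedAddCommGroup V] [NormedSpace ℝ V]

/-- The coordinate frame `∂₁φ(u), …, ∂ₙφ(u)` of a parametrised piece `φ`. -/
noncomputable def frame {n : ℕ} (φ : (Fin n → ℝ) → V) (u : Fin n → ℝ) : Fin n → V :=
  fun i => fderiv ℝ φ u (Pi.single i 1)

/-- `φ` (on the open set `U`) is the lift to `V` of a smooth local parametrisation of the subset
`L` of the torus: an immersion which, followed by the projection `V → V/Λ`, is a homeomorphism of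
`U` onto a relatively open subset of `L`. -/
structure IsLocalParam {n : ℕ} (Λ : Submodule ℤ V) (L : Set (V ⧸ Λ))
    (U : Set (Fin n → ℝ)) (φ : (Fin n → ℝ) → V) : Prop where
  isOpen : IsOpen U
  smooth : ContDiffOn ℝ ((⊤ : ℕ∞) : WithTop ℕ∞) φ U
  immersion : ∀ u ∈ U, Function.Injective (fderiv ℝ φ u)
  embedding : Topology.IsEmbedding (fun u : U => (Submodule.Quotient.mk (φ u) : V ⧸ Λ))
  image : ∃ O : Set (V ⧸ Λ), IsOpen O ∧
    (fun u => (Submodule.Quotient.mk (φ u) : V ⧸ Λ)) '' U = L ∩ O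

/-- `L` is a (non-empty) compact embedded `n`-dimensional submanifold of the torus `V/Λ` all of
whose tangent spaces are Lagrangian, and `Arg (Ω|_L)`, as an element of `ℝ/πℤ`, is the constant
`θ`. -/
def IsCompactSpecialLagrangian {n : ℕ} (ω : V [⋀^Fin 2]→ₗ[ℝ] ℝ) (Λ : Submodule ℤ V)
    (Ω : V [⋀^Fin n]→ₗ[ℝ] ℂ) (θ : ℝ) (L : Set (V ⧸ Λ)) : Prop :=
  L.Nonempty ∧ IsCompact L ∧
  ∀ p ∈ L, ∃ (U : Set (Fin n → ℝ)) (φ : (Fin n → ℝ) → V),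
    IsLocalParam Λ L U φ ∧
    (∃ u ∈ U, (Submodule.Quotient.mk (φ u) : V ⧸ Λ) = p) ∧
    ∀ u ∈ U, IsLagrangian ω (LinearMap.range (fderiv ℝ φ u).toLinearMap) ∧
      ∃ r : ℝ, r ≠ 0 ∧ Ω (frame φ u) = r * Complex.exp (θ * Complex.I)

/-- A cutting of the submanifold `L` into countably many disjoint measurable pieces, the `k`-th
one being parametrised injectively by the measurable set `A k` through the smooth map `φ k`, which
takes the open set `U k ⊇ A k` into `L`. -/
structure IsCutting {n : ℕ} (Λ : Submodule ℤ V) (L : Set (V ⧸ Λ))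
    (U A : ℕ → Set (Fin n → ℝ)) (φ : ℕ → (Fin n → ℝ) → V) : Prop where
  isOpen : ∀ k, IsOpen (U k)
  smooth : ∀ k, ContDiffOn ℝ ((⊤ : ℕ∞) : WithTop ℕ∞) (φ k) (U k)
  mapsTo : ∀ k, ∀ u ∈ U k, (Submodule.Quotient.mk (φ k u) : V ⧸ Λ) ∈ L
  subset : ∀ k, A k ⊆ U k
  measurable : ∀ k, MeasurableSet (A k)
  injOn : ∀ k, Set.InjOn (fun u => (Submodule.Quotient.mk (φ k u) : V ⧸ Λ)) (A k)
  disjoint : Pairwise fun k l => Disjoint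
    ((fun u => (Submodule.Quotient.mk (φ k u) : V ⧸ Λ)) '' A k)
    ((fun u => (Submodule.Quotient.mk (φ l u) : V ⧸ Λ)) '' A l)
  cover : (⋃ k, (fun u => (Submodule.Quotient.mk (φ k u) : V ⧸ Λ)) '' A k) = L

/-- The integral `∫_L |Ω|` of the density `|Ω|` over an `n`-dimensional submanifold `L` of the
torus: cut `L` into parametrised pieces and add up the integrals of `|Ω(∂₁φ, …, ∂ₙφ)|`. By the
change of variables formula all cuttings of a submanifold give the same value, and the infimum
only serves to select it. -/
noncomputable def densityIntegral {n : ℕ} (Λ : Submodule ℤ V) (Ω : V [⋀^Fin n]→ₗ[ℝ] ℂ)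
    (L : Set (V ⧸ Λ)) : ℝ≥0∞ :=
  ⨅ (U : ℕ → Set (Fin n → ℝ)) (A : ℕ → Set (Fin n → ℝ)) (φ : ℕ → (Fin n → ℝ) → V)
    (_ : IsCutting Λ L U A φ), ∑' k, ∫⁻ u in A k, ‖Ω (frame (φ k) u)‖ₑ

/-- The systole `Sys_Ω(V/Λ)`: the infimum of `∫_L |Ω|` over all compact special Lagrangian
submanifolds `L` of the torus, of any phase; it is `∞` if there are none. -/
noncomputable def Sys {n : ℕ} (ω : V [⋀^Fin 2]→ₗ[ℝ] ℝ) (Λ : Submodule ℤ V)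
    (Ω : V [⋀^Fin n]→ₗ[ℝ] ℂ) : ℝ≥0∞ :=
  ⨅ (L : Set (V ⧸ Λ)) (_ : ∃ θ : ℝ, IsCompactSpecialLagrangian ω Λ Ω θ L),
    densityIntegral Λ Ω L

end Submanifolds

end SympTorus

/-! The point is to find, for every `Ω`, a linear Lagrangian torus whose size is bounded
independently of the complex structure. After scaling, `Nω` is integral on `Λ`. A compatible `J`
turns `(V, Nω)` into `ℂⁿ` with `Nω` the imaginary part of the Hermitian product
(`exists_unitary_equiv`), and in every unitary basis `Ω = c · dz₁ ∧ ⋯ ∧ dzₙ`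
(`exists_eq_smul_detForm`). Hence the volume is `‖c‖²` times the symplectic volume of the torus for
`Nω` (`dVolForm_eq`, `dVolSymp_eq`), and a linear Lagrangian torus is special with `∫|Ω|` at most
`‖c‖` times its Euclidean covolume (`Sys_le`, `norm_smul_detForm_apply`). The factor `‖c‖²` cancels
from the inequality, leaving a covolume bound uniform in `J`.

The Lagrangian sublattice is built one vector at a time (`exists_isotropicBasis`). Given an
isotropic sublattice of rank `k < n` with basis matrix `A`, Minkowski's theorem is applied to a box
measured by `A⁻¹` along the sublattice, by `Aᵀ` along its image under `J`, and by the unit matrix in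
the remaining directions. The determinants of `A⁻¹` and `Aᵀ` cancel, so a box of fixed size works,
however distorted `A` is. The `Aᵀ` coordinates of a lattice vector are its integral pairings with
the sublattice; being smaller than `1` they vanish, so the new vector keeps the sublattice
isotropic, while its normal component is bounded (`exists_lattice_vector`). The lattice determinant
that enters is, up to sign, the square root of the absolute Gram determinant of `Nω`, which does not
involve `J` (`sq_det_coordMatrix`). -/

namespace SympTorus

/-! ### Exterior products of one-forms as determinants; the symplectic volume form in Darboux
coordinates -/

section DetForm

variable {V : Type*} [AddCommGroup V] [Module ℝ V] {A : Type*} [CommRing A] [Algebra ℝ A]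

/-- The exterior product of the one-forms `φ i`, that is `v ↦ det (φ i (v j))`. -/
noncomputable def detForm {ι : Type*} [Fintype ι] [DecidableEq ι] (φ : ι → V →ₗ[ℝ] A) :
    V [⋀^ι]→ₗ[ℝ] A :=
  MultilinearMap.alternatization ((MultilinearMap.mkPiAlgebra ℝ ι A).compLinearMap φ)

theorem detForm_apply {ι : Type*} [Fintype ι] [DecidableEq ι] (φ : ι → V →ₗ[ℝ] A) (v : ι → V) :
    detForm φ v = (Matrix.of fun i j => φ j (v i)).det := by
  simp [detForm, MultilinearMap.alternatization_apply, Matrix.det_apply,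
    MultilinearMap.domDomCongr_apply]

theorem wedge_apply {k l : ℕ} (α : V [⋀^Fin k]→ₗ[ℝ] A) (β : V [⋀^Fin l]→ₗ[ℝ] A)
    (v : Fin (k + l) → V) :
    wedge α β v = LinearMap.mul' ℝ A (α.domCoprod β (v ∘ finSumFinEquiv)) := rfl

/-- Antisymmetrising two tensor products separately and then shuffling is the same as
antisymmetrising their product at once, so no normalising factor appears. -/
theorem wedge_detForm {k l : ℕ} (φ : Fin k → V →ₗ[ℝ] A) (ψ : Fin l → V →ₗ[ℝ] A) :
    wedge (detForm φ) (detForm ψ) = detForm (Fin.append φ ψ) := by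
  ext v
  rw [wedge_apply, detForm, detForm, ← MultilinearMap.domCoprod_alternization, detForm_apply,
    ← Matrix.det_submatrix_equiv_self finSumFinEquiv, Matrix.det_apply,
    MultilinearMap.alternatization_apply, map_sum]
  refine Finset.sum_congr rfl fun σ _ => ?_
  rw [LinearMap.map_smul_of_tower]
  congr 1
  simp [MultilinearMap.domDomCongr_apply, MultilinearMap.domCoprod_apply]

theorem sum_alternatingMap_apply {κ ι M : Type*} [AddCommGroup M] [Module ℝ M] (s : Finset κ)
    (α : κ → V [⋀^ι]→ₗ[ℝ] M) (v : ι → V) : (∑ i ∈ s, α i) v = ∑ i ∈ s, α i v :=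
  map_sum (⟨⟨fun β : V [⋀^ι]→ₗ[ℝ] M => β v, rfl⟩, fun _ _ => rfl⟩ : V [⋀^ι]→ₗ[ℝ] M →+ M) α s

theorem wedge_sum_left {κ : Type*} (s : Finset κ) {k l : ℕ} (α : κ → V [⋀^Fin k]→ₗ[ℝ] A)
    (β : V [⋀^Fin l]→ₗ[ℝ] A) : wedge (∑ i ∈ s, α i) β = ∑ i ∈ s, wedge (α i) β := by
  ext v
  simp only [wedge_apply, ← AlternatingMap.domCoprod'_apply, TensorProduct.sum_tmul, map_sum]
  rw [sum_alternatingMap_apply, sum_alternatingMap_apply, map_sum]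
  rfl

theorem wedge_sum_right {κ : Type*} (s : Finset κ) {k l : ℕ} (α : V [⋀^Fin k]→ₗ[ℝ] A)
    (β : κ → V [⋀^Fin l]→ₗ[ℝ] A) : wedge α (∑ i ∈ s, β i) = ∑ i ∈ s, wedge α (β i) := by
  ext v
  simp only [wedge_apply, ← AlternatingMap.domCoprod'_apply, TensorProduct.tmul_sum, map_sum]
  rw [sum_alternatingMap_apply, sum_alternatingMap_apply, map_sum]
  rfl

theorem wedge_smul_left (c : ℝ) {k l : ℕ} (α : V [⋀^Fin k]→ₗ[ℝ] A)
    (β : V [⋀^Fin l]→ₗ[ℝ] A) : wedge (c • α) β = c • wedge α β := by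
  ext v
  simp only [wedge_apply, ← AlternatingMap.domCoprod'_apply, ← TensorProduct.smul_tmul', map_smul,
    AlternatingMap.smul_apply]

theorem wedge_smul_right (c : ℝ) {k l : ℕ} (α : V [⋀^Fin k]→ₗ[ℝ] A)
    (β : V [⋀^Fin l]→ₗ[ℝ] A) : wedge α (c • β) = c • wedge α β := by
  ext v
  simp only [wedge_apply, ← AlternatingMap.domCoprod'_apply, TensorProduct.tmul_smul, map_smul,
    AlternatingMap.smul_apply]

theorem wedgePow_smul (c : ℝ) (ω : V [⋀^Fin 2]→ₗ[ℝ] ℝ) (k : ℕ) :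
    wedgePow (c • ω) k = c ^ k • wedgePow ω k := by
  induction k with
  | zero => simp [wedgePow]
  | succ k ih => rw [wedgePow, ih, wedge_smul_left, wedge_smul_right, smul_smul, wedgePow, pow_succ]

/-- The family `x (f 0), y (f 0), x (f 1), y (f 1), …` of one-forms. -/
def interleave {n k : ℕ} (x y : Fin n → V →ₗ[ℝ] A) (f : Fin k → Fin n) (j : Fin (2 * k)) :
    V →ₗ[ℝ] A :=
  if (j : ℕ) % 2 = 0 then x (f ⟨j / 2, by omega⟩) else y (f ⟨j / 2, by omega⟩)

theorem append_interleave {n k : ℕ} (x y : Fin n → V →ₗ[ℝ] A) (f : Fin k → Fin n) (a : Fin n) :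
    Fin.append (interleave x y f) ![x a, y a] =
      interleave x y (Fin.snoc f a : Fin (k + 1) → Fin n) := by
  funext j
  refine Fin.addCases (fun i => ?_) (fun i => ?_) j
  · have h : (i : ℕ) / 2 < k := by omega
    simp [interleave, Fin.snoc, h]
  · fin_cases i
    · simp [interleave, Fin.snoc]
    · have h : (2 * k + 1) / 2 = k := by omega
      have h' : (2 * k + 1) % 2 = 1 := by omega
      simp [interleave, Fin.snoc, h, h']

/-- The power is expanded over all index functions `f`, repeated indices included; ordering and
vanishing are dealt with only in top degree. -/
theorem wedgePow_eq_sum {n : ℕ} {ω : V [⋀^Fin 2]→ₗ[ℝ] ℝ} {x y : Fin n → V →ₗ[ℝ] ℝ}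
    (hω : ω = ∑ i, detForm ![x i, y i]) (k : ℕ) :
    wedgePow ω k = ∑ f : Fin k → Fin n, detForm (interleave x y f) := by
  induction k with
  | zero =>
    ext v
    simp [wedgePow, detForm_apply]
  | succ k ih =>
    rw [wedgePow, ih, wedge_sum_left, ← (Fin.snocEquiv fun _ : Fin (k + 1) => Fin n).sum_comp,
      Fintype.sum_prod_type, Finset.sum_comm]
    refine Finset.sum_congr rfl fun f _ => ?_
    rw [hω, wedge_sum_right]
    refine Finset.sum_congr rfl fun a _ => ?_
    rw [wedge_detForm, append_interleave]
    rfl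

/-- Pairs `(i, ε)` listed in lexicographic order. -/
def pairEquiv (n : ℕ) : Fin n × Fin 2 ≃ Fin (2 * n) :=
  finProdFinEquiv.trans (finCongr (Nat.mul_comm n 2))

theorem interleave_pairEquiv {n k : ℕ} (x y : Fin n → V →ₗ[ℝ] A) (f : Fin k → Fin n)
    (p : Fin k × Fin 2) :
    interleave x y f (pairEquiv k p) = if p.2 = 0 then x (f p.1) else y (f p.1) := by
  obtain ⟨i, e⟩ := p
  have h : ((e : ℕ) + 2 * i) / 2 = i := by omega
  have h' : (e : ℕ) % 2 = 0 ↔ e = 0 := by omega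
  simp [interleave, pairEquiv, finProdFinEquiv, h, h']

/-- Permuting the pairs moves the `x`-columns and the `y`-columns by the same `σ`, so the total sign
is `sign σ ^ 2 = 1`. -/
theorem detForm_interleave_perm {n : ℕ} (x y : Fin n → V →ₗ[ℝ] A) (σ : Equiv.Perm (Fin n)) :
    detForm (interleave x y σ) = detForm (interleave x y id) := by
  ext v
  rw [detForm_apply, detForm_apply]
  set τ : Equiv.Perm (Fin n × Fin 2) := Equiv.prodCongrLeft fun _ => σ
  set τ' : Equiv.Perm (Fin (2 * n)) := (pairEquiv n).permCongr τ
  have hs : Equiv.Perm.sign τ' = 1 := by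
    rw [Equiv.Perm.sign_permCongr, Equiv.Perm.sign_prodCongrLeft]
    simp
  have := Matrix.det_permute' τ' (Matrix.of fun i j => interleave x y id j (v i))
  rw [hs] at this
  simp only [Units.val_one, Int.cast_one, one_mul] at this
  rw [← this]
  congr 1
  ext i j
  obtain ⟨p, rfl⟩ := (pairEquiv n).surjective j
  have : τ' (pairEquiv n p) = pairEquiv n (σ p.1, p.2) := by
    simp [τ', τ, Equiv.permCongr_apply, Equiv.prodCongrLeft]
  simp [this, interleave_pairEquiv]

theorem detForm_eq_zero_of_eq {ι : Type*} [Fintype ι] [DecidableEq ι] (φ : ι → V →ₗ[ℝ] A)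
    {i j : ι} (hij : i ≠ j) (h : φ i = φ j) : detForm φ = 0 := by
  ext v
  rw [detForm_apply]
  exact Matrix.det_zero_of_column_eq hij fun k => by simp [h]

/-- An index function with a repetition gives two equal columns; the remaining ones are the `n!`
permutations, which all contribute equally. -/
theorem wedgePow_top {n : ℕ} {ω : V [⋀^Fin 2]→ₗ[ℝ] ℝ} {x y : Fin n → V →ₗ[ℝ] ℝ}
    (hω : ω = ∑ i, detForm ![x i, y i]) :
    wedgePow ω n = (n.factorial : ℝ) • detForm (interleave x y id) := by
  rw [wedgePow_eq_sum hω]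
  have h0 : ∀ f : Fin n → Fin n, f ∉ Set.range ((↑) : Equiv.Perm (Fin n) → Fin n → Fin n) →
      detForm (interleave x y f) = 0 := by
    intro f hf
    have hinj : ¬ Function.Injective f := fun h =>
      hf ⟨Equiv.ofBijective f (Finite.injective_iff_bijective.mp h), rfl⟩
    obtain ⟨i, j, hij, hne⟩ := Function.not_injective_iff.mp hinj
    refine detForm_eq_zero_of_eq _ (i := pairEquiv n (i, 0)) (j := pairEquiv n (j, 0)) ?_ ?_
    · simpa using hne
    · simp [interleave_pairEquiv, hij]
  rw [← Fintype.sum_of_injective ((↑) : Equiv.Perm (Fin n) → Fin n → Fin n) DFunLike.coe_injective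
    (fun σ => detForm (interleave x y σ)) _ h0 fun _ => rfl]
  simp [detForm_interleave_perm, Fintype.card_perm, ← Nat.cast_smul_eq_nsmul ℝ]

theorem dVolSymp_eq {n : ℕ} {ω : V [⋀^Fin 2]→ₗ[ℝ] ℝ} {x y : Fin n → V →ₗ[ℝ] ℝ}
    (hω : ω = ∑ i, detForm ![x i, y i]) : dVolSymp n ω = detForm (interleave x y id) := by
  rw [dVolSymp, wedgePow_top hω, smul_smul, inv_mul_cancel₀ (by positivity), one_smul]

/-- The enumeration of `x₁, …, xₙ, y₁, …, yₙ` in the order `x₁, y₁, …, xₙ, yₙ`. -/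
def shuffleEquiv (n : ℕ) : Fin n ⊕ Fin n ≃ Fin (2 * n) :=
  Equiv.trans (β := Fin n × Fin 2)
    { toFun := Sum.elim (fun i => (i, 0)) (fun i => (i, 1))
      invFun := fun p => if p.2 = 0 then Sum.inl p.1 else Sum.inr p.1
      left_inv := by rintro (i | i) <;> simp
      right_inv := by
        rintro ⟨i, e⟩
        fin_cases e <;> simp }
    (pairEquiv n)

/-- The perfect shuffle. -/
def shufflePerm (n : ℕ) : Equiv.Perm (Fin (n + n)) :=
  (finSumFinEquiv.symm.trans (shuffleEquiv n)).trans (finCongr (two_mul n))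

theorem shufflePerm_castAdd {n : ℕ} (i : Fin n) :
    ((shufflePerm n (Fin.castAdd n i) : Fin (n + n)) : ℕ) = 2 * i := by
  simp [shufflePerm, shuffleEquiv, pairEquiv]

theorem shufflePerm_natAdd {n : ℕ} (i : Fin n) :
    ((shufflePerm n (Fin.natAdd n i) : Fin (n + n)) : ℕ) = 2 * i + 1 := by
  simp [-Fin.natAdd_eq_addNat, shufflePerm, shuffleEquiv, pairEquiv, add_comm]

/-- The only inversions are between `xᵢ` and `yⱼ` with `j < i`. There are `i` of them for each `i`,
hence `n(n-1)/2` in all; this is the source of the sign in `dVolForm`. -/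
theorem sign_shufflePerm (n : ℕ) :
    Equiv.Perm.sign (shufflePerm n) = (-1) ^ (n * (n - 1) / 2) := by
  have key : ∀ j : Fin (n + n), ∏ i ∈ Finset.Iio j,
      (if shufflePerm n i < shufflePerm n j then (1 : ℤˣ) else -1) =
      ∏ i, (if i < j then (if shufflePerm n i < shufflePerm n j then (1 : ℤˣ) else -1) else 1) := by
    intro j
    rw [← Finset.prod_filter]
    congr 1
    ext i
    simp
  rw [Equiv.Perm.sign_eq_prod_prod_Iio, Finset.prod_congr rfl fun j _ => key j]
  simp only [Fin.prod_univ_add, Fin.lt_def, shufflePerm_castAdd, shufflePerm_natAdd,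
    Fin.val_castAdd, Fin.val_natAdd]
  have h1 : ∀ j i : Fin n, (if (i : ℕ) < j then if 2 * (i : ℕ) < 2 * j then (1 : ℤˣ) else -1
      else 1) = 1 := by
    intro j i
    split_ifs <;> first | rfl | omega
  have h2 : ∀ j i : Fin n, (if n + (i : ℕ) < j then if 2 * (i : ℕ) + 1 < 2 * j then (1 : ℤˣ)
      else -1 else 1) = 1 := by
    intro j i
    split_ifs <;> first | rfl | omega
  have h3 : ∀ j i : Fin n, (if n + (i : ℕ) < n + j then
      if 2 * (i : ℕ) + 1 < 2 * j + 1 then (1 : ℤˣ) else -1 else 1) = 1 := by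
    intro j i
    split_ifs <;> first | rfl | omega
  have h4 : ∀ j i : Fin n, (if (i : ℕ) < n + j then
      if 2 * (i : ℕ) < 2 * j + 1 then (1 : ℤˣ) else -1 else 1) =
      if (j : ℕ) < i then -1 else 1 := by
    intro j i
    split_ifs <;> first | rfl | omega
  simp only [h1, h2, h3, h4, Finset.prod_const_one, one_mul, mul_one]
  rw [Finset.prod_comm]
  have h5 : ∀ i : Fin n, ∏ j : Fin n, (if (j : ℕ) < i then (-1 : ℤˣ) else 1) = (-1) ^ (i : ℕ) := by
    intro i
    rw [Finset.prod_ite, Finset.prod_const, Finset.prod_const_one, mul_one]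
    congr 1
    have := Fin.card_Iio i
    rw [← this]
    congr 1
    ext j
    simp
  rw [Finset.prod_congr rfl fun i _ => h5 i, Finset.prod_pow_eq_pow_sum,
    Fin.sum_univ_eq_sum_range (fun i => i), Finset.sum_range_id]

theorem detForm_append {n : ℕ} (x y : Fin n → V →ₗ[ℝ] A) :
    (detForm (Fin.append x y)).domDomCongr (finCongr (two_mul n).symm) =
      ((-1 : ℝ) ^ (n * (n - 1) / 2)) • detForm (interleave x y id) := by
  ext v
  rw [AlternatingMap.domDomCongr_apply, AlternatingMap.smul_apply, detForm_apply, detForm_apply]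
  have := Matrix.det_permute' (shufflePerm n) (Matrix.of fun i j : Fin (n + n) =>
    interleave x y id (finCongr (two_mul n).symm j) (v (finCongr (two_mul n).symm i)))
  rw [sign_shufflePerm] at this
  rw [← Matrix.det_submatrix_equiv_self (finCongr (two_mul n).symm)
    (Matrix.of fun i j => interleave x y id j (v i))]
  have h : ∀ a : A, ((-1 : ℝ) ^ (n * (n - 1) / 2)) • a =
      ((((-1 : ℤˣ) ^ (n * (n - 1) / 2) : ℤˣ) : ℤ) : A) * a := by
    intro a
    rcases Nat.even_or_odd (n * (n - 1) / 2) with h | h <;> simp [h.neg_one_pow]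
  rw [h]
  refine Eq.trans ?_ this
  congr 1
  ext i j
  have e : ∀ s, finCongr (two_mul n).symm (shufflePerm n (finSumFinEquiv s)) = shuffleEquiv n s := by
    intro s
    simp [shufflePerm]
  obtain ⟨s, rfl⟩ := finSumFinEquiv.surjective j
  rcases s with s | s
  · simp [-finCongr_apply, -finSumFinEquiv_apply_left, e, shuffleEquiv, interleave_pairEquiv]
    simp
  · simp [-finCongr_apply, -finSumFinEquiv_apply_right, e, shuffleEquiv, interleave_pairEquiv]
    simp [-Fin.natAdd_eq_addNat]

end DetForm

/-! ### The volume form of a multiple of `dz₁ ∧ ⋯ ∧ dzₙ` -/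

section Volume

variable {V : Type*} [AddCommGroup V] [Module ℝ V]

/-- The complex coordinate `x + i y`. -/
noncomputable def complexCoord (x y : V →ₗ[ℝ] ℝ) : V →ₗ[ℝ] ℂ :=
  Complex.ofRealAm.toLinearMap ∘ₗ x + Complex.I • (Complex.ofRealAm.toLinearMap ∘ₗ y)

theorem complexCoord_apply (x y : V →ₗ[ℝ] ℝ) (v : V) :
    complexCoord x y v = x v + Complex.I * y v := rfl

theorem conjForm_detForm {n : ℕ} (c : ℂ) (x y : Fin n → V →ₗ[ℝ] ℝ) :
    conjForm (c • detForm fun i => complexCoord (x i) (y i)) =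
      (starRingEnd ℂ) c • detForm fun i => complexCoord (x i) (-y i) := by
  ext v
  simp only [conjForm, LinearMap.compAlternatingMap_apply, AlternatingMap.smul_apply,
    detForm_apply, smul_eq_mul]
  change (starRingEnd ℂ) _ = _
  rw [map_mul, RingHom.map_det]
  congr 2
  ext i j
  simp [complexCoord_apply]

/-- The domain coproduct is bilinear only over `ℝ`, so complex scalars are extracted from each
shuffle term. -/
theorem wedge_smul_smul {k l : ℕ} (c d : ℂ) (α : V [⋀^Fin k]→ₗ[ℝ] ℂ) (β : V [⋀^Fin l]→ₗ[ℝ] ℂ) :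
    wedge (c • α) (d • β) = (c * d) • wedge α β := by
  ext v
  rw [AlternatingMap.smul_apply, wedge_apply, wedge_apply, AlternatingMap.domCoprod_apply,
    AlternatingMap.domCoprod_apply, _root_.sum_apply, _root_.sum_apply, map_sum, map_sum,
    Finset.smul_sum]
  refine Finset.sum_congr rfl fun σ _ => ?_
  induction σ using Quotient.inductionOn' with
  | h σ =>
    rw [AlternatingMap.domCoprod.summand_mk'', AlternatingMap.domCoprod.summand_mk'']
    rcases Int.units_eq_one_or (Equiv.Perm.sign σ) with h | h <;>
      simp [h, MultilinearMap.domCoprod_apply] <;> ring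

/-- The coordinates `(z, z̄)` come from `(x, y)` by the block matrix with rows `(1, 1)` and `(i,
-i)`, whose determinant is `(-2i)ⁿ`. -/
theorem detForm_append_complexCoord {n : ℕ} (x y : Fin n → V →ₗ[ℝ] ℝ) (v : Fin (n + n) → V) :
    detForm (Fin.append (fun i => complexCoord (x i) (y i)) fun i => complexCoord (x i) (-y i)) v =
      (-2 * Complex.I) ^ n * (detForm (Fin.append x y) v : ℂ) := by
  rw [detForm_apply, detForm_apply, ← Matrix.det_submatrix_equiv_self finSumFinEquiv,
    ← Matrix.det_submatrix_equiv_self finSumFinEquiv (Matrix.of _ : Matrix _ _ ℝ)]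
  have hd : (Matrix.fromBlocks (1 : Matrix (Fin n) (Fin n) ℂ) 1
      (Complex.I • 1) (-(Complex.I • 1) : Matrix (Fin n) (Fin n) ℂ)).det =
      (-2 * Complex.I) ^ n := by
    rw [Matrix.det_fromBlocks_one₁₁, show (-(Complex.I • 1) - Complex.I • 1 * 1 :
      Matrix (Fin n) (Fin n) ℂ) = (-2 * Complex.I) • 1 by rw [mul_one]; module, Matrix.det_smul]
    simp
  rw [mul_comm, ← hd, ← Complex.ofRealHom_eq_coe, RingHom.map_det, ← Matrix.det_mul]
  congr 1
  ext i j
  rw [Matrix.mul_apply, Fintype.sum_sum_type]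
  rcases j with j | j <;>
    simp [-Fin.natAdd_eq_addNat, complexCoord_apply, Matrix.one_apply, mul_comm]

/-- The factor `(i/2)ⁿ` cancels `(-2i)ⁿ`, and the sign `(-1)^(n(n-1)/2)` cancels the sign of the
perfect shuffle. -/
theorem dVolForm_eq {n : ℕ} (c : ℂ) (x y : Fin n → V →ₗ[ℝ] ℝ) (v : Fin (2 * n) → V) :
    dVolForm (c • detForm fun i => complexCoord (x i) (y i)) v =
      ((‖c‖ ^ 2 * detForm (interleave x y id) v : ℝ) : ℂ) := by
  have h1 := congrArg (fun f => f v) (detForm_append x y)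
  simp only [AlternatingMap.domDomCongr_apply, AlternatingMap.smul_apply, smul_eq_mul] at h1
  rw [dVolForm, conjForm_detForm, wedge_smul_smul, wedge_detForm, AlternatingMap.smul_apply,
    AlternatingMap.domDomCongr_apply, AlternatingMap.smul_apply, detForm_append_complexCoord, h1,
    Complex.mul_conj, Complex.normSq_eq_norm_sq]
  push_cast
  simp only [smul_eq_mul]
  have h2 : (Complex.I / 2) ^ n * (-2 * Complex.I) ^ n = 1 := by
    rw [← mul_pow]
    have : Complex.I / 2 * (-2 * Complex.I) = 1 := by
      linear_combination -Complex.I_mul_I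
    rw [this, one_pow]
  have h3 : (-1 : ℂ) ^ (n * (n - 1) / 2) * (-1) ^ (n * (n - 1) / 2) = 1 := by
    rw [← mul_pow]; simp
  linear_combination ((‖c‖ : ℂ) ^ 2 * (detForm (interleave x y id) v : ℂ)) *
    ((-1 : ℂ) ^ (n * (n - 1) / 2) * (-1) ^ (n * (n - 1) / 2) * h2 + h3)

end Volume

/-! ### Geometry of numbers: linear forms on a box -/

section Minkowski

open MeasureTheory

/-- Minkowski's theorem on linear forms. -/
theorem exists_int_abs_mulVec_lt {ι : Type*} [Fintype ι] [DecidableEq ι] (B : Matrix ι ι ℝ)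
    (hB : B.det ≠ 0) (r : ι → ℝ) (hr : ∀ i, 0 < r i) (h : |B.det| < ∏ i, r i) :
    ∃ m : ι → ℤ, m ≠ 0 ∧ ∀ i, |B.mulVec (fun j => (m j : ℝ)) i| < r i := by
  have hli : LinearIndependent ℝ B.transpose.row :=
    Matrix.linearIndependent_rows_of_det_ne_zero (A := B.transpose) (by rwa [Matrix.det_transpose])
  let b : Module.Basis ι ℝ (ι → ℝ) := basisOfLinearIndependentOfCardEqFinrank' _ hli (by simp)
  have hb : ∀ j i, b j i = B i j := by
    intro j i
    simp only [b, coe_basisOfLinearIndependentOfCardEqFinrank']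
    rfl
  have hb' : (Matrix.of b).det = B.det := by
    rw [← Matrix.det_transpose]
    congr 1
    ext i j
    simp [hb]
  set s : Set (ι → ℝ) := Set.univ.pi fun i => Set.Ioo (-(r i)) (r i)
  have hs : volume s = ENNReal.ofReal (∏ i, (2 * r i)) := by
    rw [Real.volume_pi_Ioo, ENNReal.ofReal_prod_of_nonneg fun i _ => by linarith [hr i]]
    exact Finset.prod_congr rfl fun i _ => by congr 1; ring
  have hc : Convex ℝ s := convex_pi fun i _ => convex_Ioo _ _
  have hsymm : ∀ x ∈ s, -x ∈ s := by
    intro x hx i hi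
    have := hx i hi
    simp only [Set.mem_Ioo, Pi.neg_apply] at this ⊢
    constructor <;> linarith [this.1, this.2]
  have hF := ZSpan.isAddFundamentalDomain b volume
  have : Countable (Submodule.span ℤ (Set.range b)).toAddSubgroup :=
    inferInstanceAs (Countable (Submodule.span ℤ (Set.range b)))
  obtain ⟨⟨x, hx⟩, hx0, hxs⟩ := exists_ne_zero_mem_lattice_of_measure_mul_two_pow_lt_measure
    (L := (Submodule.span ℤ (Set.range b)).toAddSubgroup) hF hsymm hc (by
      rw [ZSpan.volume_fundamentalDomain, hb', hs, Module.finrank_fintype_fun_eq_card,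
        Finset.prod_mul_distrib, Finset.prod_const, mul_comm,
        ENNReal.ofReal_mul (by positivity)]
      have : (2 : ℝ≥0∞) ^ Fintype.card ι = ENNReal.ofReal (2 ^ Finset.univ.card (α := ι)) := by
        rw [ENNReal.ofReal_pow (by norm_num)]
        simp
      rw [this]
      refine ENNReal.mul_lt_mul_right (by simp) (by simp) ?_
      exact (ENNReal.ofReal_lt_ofReal_iff (Finset.prod_pos fun i _ => hr i)).mpr h)
  have hx' := (Submodule.mem_span_range_iff_exists_fun ℤ).mp hx
  obtain ⟨m, rfl⟩ := hx'
  refine ⟨m, ?_, fun i => ?_⟩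
  · rintro rfl
    exact hx0 (by simp)
  · have := hxs i (Set.mem_univ i)
    rw [abs_lt]
    convert this using 2
    simp [Matrix.mulVec, dotProduct, hb, mul_comm]

end Minkowski

/-! ### Saturated sublattices -/

section Saturation

variable {V : Type*} [NormedAddCommGroup V] [NormedSpace ℝ V] [FiniteDimensional ℝ V]

/-- Every sublattice spanned by independent vectors is contained in a saturated one with the same
real span. -/
theorem exists_saturated_family (Λ : Submodule ℤ V) [DiscreteTopology Λ] {k : ℕ} (v : Fin k → V)
    (hv : LinearIndependent ℝ v) (hΛ : ∀ i, v i ∈ Λ) :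
    ∃ (u : Fin k → V) (P : Matrix (Fin k) (Fin k) ℤ), LinearIndependent ℝ u ∧ (∀ i, u i ∈ Λ) ∧
      (∀ j, v j = ∑ i, (P i j : ℝ) • u i) ∧ P.det ≠ 0 ∧
      ∀ a : Fin k → ℝ, ∑ i, a i • u i ∈ Λ → ∀ i, ∃ m : ℤ, a i = m := by
  set S : Submodule ℝ V := Submodule.span ℝ (Set.range v)
  -- The intersection of `Λ` with the real span is a full lattice there; its `ℤ`-basis is the
  -- saturated family.
  set N : Submodule ℤ S := ZLattice.comap ℝ Λ S.subtype
  have hN : DiscreteTopology N := ZLattice.comap_discreteTopology ℝ Λ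
    (LinearMap.continuous_of_finiteDimensional S.subtype) S.injective_subtype
  have hvS : ∀ i, v i ∈ S := fun i => Submodule.subset_span ⟨i, rfl⟩
  have hZ : IsZLattice ℝ N := ⟨by
    rw [eq_top_iff]
    have := (Module.Basis.span hv).span_eq
    rw [← this]
    refine Submodule.span_mono ?_
    rintro _ ⟨i, rfl⟩
    have : S.subtype (Module.Basis.span hv i) = v i := by
      exact congrArg Subtype.val (Module.Basis.span_apply hv i)
    change S.subtype _ ∈ Λ
    rw [this]
    exact hΛ i⟩
  have hcard : Module.finrank ℤ N = k := by
    rw [ZLattice.rank ℝ N, finrank_span_eq_card hv, Fintype.card_fin]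
  let b : Module.Basis (Fin k) ℤ N := Module.finBasisOfFinrankEq ℤ N hcard
  let bR := b.ofZLatticeBasis ℝ N
  let w : Fin k → N := fun j => ⟨⟨v j, hvS j⟩, hΛ j⟩
  have hu : LinearIndependent ℝ (fun i => (bR i : V)) :=
    bR.linearIndependent.map' S.subtype (Submodule.ker_subtype S)
  have hP : ∀ j, v j = ∑ i, ((b.repr (w j) i : ℤ) : ℝ) • (bR i : V) := by
    intro j
    have := bR.sum_repr (w j : S)
    have := congrArg (Subtype.val) this
    simp only [bR, Module.Basis.ofZLatticeBasis_repr_apply] at this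
    rw [Submodule.coe_sum] at this
    exact this.symm
  refine ⟨fun i => (bR i : V), Matrix.of fun i j => b.repr (w j) i, hu, fun i => ?_, hP, ?_, ?_⟩
  · have : bR i = (b i : S) := by simp [bR]
    simp only [this]
    exact (b i).2
  -- A singular integer matrix has a nonzero integer kernel vector, which would be a linear relation
  -- between the `v j`.
  · intro h0
    obtain ⟨c, hc, hc0⟩ := Matrix.exists_mulVec_eq_zero_iff.mpr h0
    have : ∑ j, (c j : ℝ) • v j = 0 := by
      simp_rw [hP, Finset.smul_sum, smul_smul]
      rw [Finset.sum_comm]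
      refine Finset.sum_eq_zero fun i _ => ?_
      rw [← Finset.sum_smul]
      have h1 := congrFun hc0 i
      simp only [Matrix.mulVec, dotProduct, Matrix.of_apply, Pi.zero_apply] at h1
      have h2 : ∑ j, (c j : ℝ) * ((b.repr (w j) i : ℤ) : ℝ) = 0 := by
        rw [← Int.cast_zero, ← h1]
        push_cast
        exact Finset.sum_congr rfl fun _ _ => mul_comm _ _
      rw [h2, zero_smul]
    have h3 := Fintype.linearIndependent_iff.mp hv _ this
    exact hc (funext fun j => by simpa using h3 j)
  · intro a ha i
    have hmem : (∑ i, a i • bR i : S) ∈ N := by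
      change S.subtype _ ∈ Λ
      simpa using ha
    refine ⟨b.repr ⟨_, hmem⟩ i, ?_⟩
    rw [← Module.Basis.ofZLatticeBasis_repr_apply ℝ N b]
    change a i = bR.repr (∑ i, a i • bR i) i
    rw [bR.repr_sum_self]

end Saturation

/-! ### Enlarging an isotropic sublattice by one short vector -/

section Isotropic

open scoped InnerProductSpace

variable {E : Type*} [NormedAddCommGroup E] [InnerProductSpace ℂ E]
  {V : Type*} [NormedAddCommGroup V] [NormedSpace ℝ V]

/-- The real and imaginary parts of the coordinates of `b j` in an orthonormal basis. -/
noncomputable def coordMatrix {σ ι : Type*} [Fintype σ] (f : OrthonormalBasis σ ℂ E)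
    (g : ι → E) : Matrix (σ ⊕ σ) ι ℝ :=
  Matrix.of (Sum.elim (fun s j => (⟪f s, g j⟫_ℂ).re) (fun s j => (⟪f s, g j⟫_ℂ).im))

/-- In unitary coordinates the imaginary part of the Hermitian product is the standard symplectic
form, so the Gram matrix is `-(Xᵀ J X)` with `|det J| = 1`. The determinant of the lattice in these
coordinates is thereby controlled by the symplectic form alone. -/
theorem sq_det_coordMatrix {σ : Type*} [Fintype σ] [DecidableEq σ]
    (f : OrthonormalBasis σ ℂ E) (g : σ ⊕ σ → E) :
    (coordMatrix f g).det ^ 2 = |(Matrix.of fun i j => (⟪g i, g j⟫_ℂ).im).det| := by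
  have h : (Matrix.of fun i j => (⟪g i, g j⟫_ℂ).im) =
      -((coordMatrix f g).transpose * Matrix.J σ ℝ * coordMatrix f g) := by
    ext i j
    rw [Matrix.mul_assoc, Matrix.of_apply, ← f.sum_inner_mul_inner]
    simp only [Matrix.neg_apply, Matrix.mul_apply, Fintype.sum_sum_type, Matrix.transpose_apply,
      coordMatrix, Matrix.of_apply, Matrix.J, Sum.elim_inl, Sum.elim_inr,
      Matrix.fromBlocks_apply₁₁, Matrix.fromBlocks_apply₁₂, Matrix.fromBlocks_apply₂₁,
      Matrix.fromBlocks_apply₂₂, Matrix.zero_apply, Matrix.neg_apply, Matrix.one_apply]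
    simp only [zero_mul, Finset.sum_const_zero, zero_add, add_zero, neg_mul, ite_mul, one_mul,
      Finset.sum_neg_distrib, Finset.sum_ite_eq, Finset.mem_univ, if_true, mul_neg,
      Complex.im_sum]
    rw [neg_add, neg_neg, ← Finset.sum_neg_distrib, ← Finset.sum_add_distrib]
    refine Finset.sum_congr rfl fun s _ => ?_
    have hre : (⟪g i, f s⟫_ℂ).re = (⟪f s, g i⟫_ℂ).re := inner_re_symm (𝕜 := ℂ) _ _
    have him : (⟪g i, f s⟫_ℂ).im = -(⟪f s, g i⟫_ℂ).im := inner_im_symm (𝕜 := ℂ) _ _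
    rw [Complex.mul_im, hre, him]
    ring
  have hJ : |(Matrix.J σ ℝ).det| = 1 := by
    have := Matrix.J_det_mul_J_det σ ℝ
    rw [← abs_mul_abs_self] at this
    nlinarith [abs_nonneg (Matrix.J σ ℝ).det]
  rw [h, Matrix.det_neg, abs_mul, Matrix.det_mul, Matrix.det_mul, Matrix.det_transpose, abs_mul,
    abs_mul, hJ, abs_pow, abs_neg, abs_one, one_pow, one_mul, mul_one, abs_mul_abs_self, sq]

/-- Minkowski's theorem in coordinates adapted to the sublattice. Integrality makes the vector found
symplectically orthogonal to all `v i`, saturation keeps it out of their span, and the box bounds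
its normal part `w`. -/
theorem exists_lattice_vector {Λ : Submodule ℤ V} (Φ : V ≃ₗ[ℝ] E) {k m : ℕ} (hm : 0 < m)
    (b : Module.Basis ((Fin k ⊕ Fin m) ⊕ (Fin k ⊕ Fin m)) ℤ Λ)
    (hint : ∀ u ∈ Λ, ∀ v ∈ Λ, ∃ z : ℤ, (⟪Φ u, Φ v⟫_ℂ).im = z)
    (f : OrthonormalBasis (Fin k ⊕ Fin m) ℂ E) (A : Matrix (Fin k) (Fin k) ℝ) (hA : A.det ≠ 0)
    (v : Fin k → V) (hv : ∀ i, v i ∈ Λ)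
    (hvA : ∀ j, Φ (v j) = ∑ i, (A i j : ℂ) • f (Sum.inl i))
    (hsat : ∀ a : Fin k → ℝ, ∑ i, a i • v i ∈ Λ → ∀ i, ∃ z : ℤ, a i = z)
    (ρ : ℝ) (hρ : 1 ≤ ρ) (hdet0 : (coordMatrix f fun j => Φ (b j : V)).det ≠ 0)
    (hdet : |(coordMatrix f fun j => Φ (b j : V)).det| < ρ) :
    ∃ x ∈ Λ, ∃ (a : Fin k → ℝ) (w : E), Φ x = ∑ i, (a i : ℂ) • Φ (v i) + w ∧ w ≠ 0 ∧
      (∀ i, ⟪f (Sum.inl i), w⟫_ℂ = 0) ∧ ‖w‖ ≤ 2 * m * ρ := by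
  set X := coordMatrix f fun j => Φ (b j : V)
  -- Real tangential coordinates are multiplied by `A⁻¹`, imaginary ones by `Aᵀ`, normal ones are
  -- unchanged. This has determinant `1`, so the bound does not depend on `A`.
  set T : Matrix ((Fin k ⊕ Fin m) ⊕ (Fin k ⊕ Fin m)) ((Fin k ⊕ Fin m) ⊕ (Fin k ⊕ Fin m)) ℝ :=
    Matrix.fromBlocks (Matrix.fromBlocks A⁻¹ 0 0 1) 0 0 (Matrix.fromBlocks A.transpose 0 0 1)
  have hAu : IsUnit A.det := isUnit_iff_ne_zero.mpr hA
  have hT : T.det = 1 := by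
    simp only [T, Matrix.det_fromBlocks_zero₂₁, Matrix.det_one, mul_one, Matrix.det_transpose]
    rw [← Matrix.det_mul, Matrix.nonsing_inv_mul _ hAu, Matrix.det_one]
  have hTX : (T * X).det = X.det := by rw [Matrix.det_mul, hT, one_mul]
  obtain ⟨z, hz0, hz⟩ := exists_int_abs_mulVec_lt (T * X) (by rwa [hTX])
    (Sum.elim (Sum.elim 1 fun _ => ρ) (Sum.elim 1 fun _ => ρ))
    (by rintro ((i | i) | (i | i)) <;> simp <;> linarith) (by
      rw [hTX]
      simp only [Fintype.prod_sum_type, Sum.elim_inl, Sum.elim_inr, Pi.one_apply,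
        Finset.prod_const_one, one_mul, Finset.prod_const, Finset.card_univ, Fintype.card_fin]
      rw [← pow_add]
      -- The sides `ρ` occur `2m` times; `m > 0` and `1 ≤ ρ` give `ρ ≤ ρ ^ (2m)`.
      exact hdet.trans_le (le_self_pow₀ hρ (by omega)))
  set x : Λ := ∑ j, z j • b j
  have hΦx : Φ (x : V) = ∑ j, (z j : ℝ) • Φ (b j : V) := by
    simp only [x, Submodule.coe_sum, map_sum, Submodule.coe_smul, map_zsmul,
      Int.cast_smul_eq_zsmul]
  set c : Fin k ⊕ Fin m → ℂ := fun s => ⟪f s, Φ (x : V)⟫_ℂ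
  have hXz : X.mulVec (fun j => (z j : ℝ)) =
      Sum.elim (fun s => (c s).re) fun s => (c s).im := by
    funext s
    rcases s with s | s <;>
      simp [X, coordMatrix, Matrix.mulVec, dotProduct, c, hΦx, mul_comm,
        ← Complex.coe_smul]
  simp only [← Matrix.mulVec_mulVec, hXz] at hz
  have h1 : ∀ i, |(A⁻¹.mulVec fun i => (c (Sum.inl i)).re) i| < 1 := by
    intro i
    have := hz (Sum.inl (Sum.inl i))
    simpa [T, Matrix.fromBlocks_mulVec, Function.comp_def] using this
  have h2 : ∀ i, |(A.transpose.mulVec fun i => (c (Sum.inl i)).im) i| < 1 := by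
    intro i
    have := hz (Sum.inr (Sum.inl i))
    simpa [T, Matrix.fromBlocks_mulVec, Function.comp_def] using this
  have h3 : ∀ i, |(c (Sum.inr i)).re| < ρ := by
    intro i
    have := hz (Sum.inl (Sum.inr i))
    simpa [T, Matrix.fromBlocks_mulVec, Function.comp_def] using this
  have h4 : ∀ i, |(c (Sum.inr i)).im| < ρ := by
    intro i
    have := hz (Sum.inr (Sum.inr i))
    simpa [T, Matrix.fromBlocks_mulVec, Function.comp_def] using this
  -- These entries are the pairings of `x` with the `v i`: integers of absolute value less than `1`.
  have h5 : (A.transpose.mulVec fun i => (c (Sum.inl i)).im) = 0 := by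
    funext i
    have h : (A.transpose.mulVec fun i => (c (Sum.inl i)).im) i =
        (⟪Φ (v i), Φ (x : V)⟫_ℂ).im := by
      simp [hvA, Matrix.mulVec, dotProduct, c]
    obtain ⟨q, hq⟩ := hint _ (hv i) _ x.2
    have h' := h2 i
    rw [h, hq] at h'
    rw [h, hq]
    have : |q| < 1 := by exact_mod_cast h'
    simp [Int.abs_lt_one_iff.mp this]
  have h6 : (fun i => (c (Sum.inl i)).im) = 0 :=
    Matrix.eq_zero_of_mulVec_eq_zero (by rwa [Matrix.det_transpose]) h5
  set a : Fin k → ℝ := A⁻¹.mulVec fun i => (c (Sum.inl i)).re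
  have hAa : A.mulVec a = fun i => (c (Sum.inl i)).re := by
    simp only [a, Matrix.mulVec_mulVec, Matrix.mul_nonsing_inv _ hAu, Matrix.one_mulVec]
  set w : E := ∑ i, c (Sum.inr i) • f (Sum.inr i)
  have hxw : Φ (x : V) = ∑ i, (a i : ℂ) • Φ (v i) + w := by
    rw [← f.sum_repr' (Φ (x : V)), Fintype.sum_sum_type]
    congr 1
    simp_rw [hvA, Finset.smul_sum, smul_smul]
    rw [Finset.sum_comm]
    refine Finset.sum_congr rfl fun i _ => ?_
    rw [← Finset.sum_smul]
    congr 1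
    have e1 := congrFun hAa i
    have e2 := congrFun h6 i
    simp only [Matrix.mulVec, dotProduct] at e1
    apply Complex.ext
    · simpa [mul_comm, c] using e1.symm
    · simpa [c] using e2
  refine ⟨x, x.2, a, w, hxw, ?_, ?_, ?_⟩
  -- If `w = 0`, then `x` lies in the span of `v`; saturation makes the coefficients `a i` integral,
  -- and `|a i| < 1` forces `x = 0`, although Minkowski's vector is nonzero.
  · intro hw0
    have hxv : (x : V) = ∑ i, a i • v i := by
      apply Φ.injective
      rw [hxw, hw0, add_zero, map_sum]
      simp
    have ha : a = 0 := by
      funext i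
      obtain ⟨q, hq⟩ := hsat a (hxv ▸ x.2) i
      have := h1 i
      change |a i| < 1 at this
      rw [hq] at this ⊢
      have : |q| < 1 := by exact_mod_cast this
      simp [Int.abs_lt_one_iff.mp this]
    have hx0 : x = 0 := by
      apply Subtype.ext
      rw [hxv, ha]
      simp
    exact hz0 (funext fun j => Fintype.linearIndependent_iff.mp b.linearIndependent z hx0 j)
  · intro i
    simp only [w, inner_sum, inner_smul_right]
    refine Finset.sum_eq_zero fun j _ => ?_
    rw [f.orthonormal.2 (by simp), mul_zero]
  · calc ‖w‖ ≤ ∑ i, ‖c (Sum.inr i) • f (Sum.inr i)‖ := norm_sum_le _ _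
      _ ≤ ∑ _i : Fin m, 2 * ρ := by
        refine Finset.sum_le_sum fun i _ => ?_
        rw [norm_smul, f.norm_eq_one, mul_one]
        have := Complex.norm_le_abs_re_add_abs_im (c (Sum.inr i))
        linarith [h3 i, h4 i]
      _ = 2 * m * ρ := by simp; ring

end Isotropic

/-! ### Lagrangian sublattices of bounded covolume -/

section Isotropic

open scoped InnerProductSpace

variable {E : Type*} [NormedAddCommGroup E] [InnerProductSpace ℂ E]
  {V : Type*} [NormedAddCommGroup V] [NormedSpace ℝ V]

theorem map_sum_smul_eq {n : ℕ} {Φ : V ≃ₗ[ℝ] E} {A : Matrix (Fin n) (Fin n) ℝ} {v : Fin n → V}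
    {e : Fin n → E} (hv : ∀ j, Φ (v j) = ∑ i, (A i j : ℂ) • e i)
    (a : Fin n → ℝ) : Φ (∑ j, a j • v j) = ∑ i, ((A.mulVec a i : ℝ) : ℂ) • e i := by
  simp_rw [map_sum, map_smul, hv, ← Complex.coe_smul, Finset.smul_sum, smul_smul]
  rw [Finset.sum_comm]
  refine Finset.sum_congr rfl fun i _ => ?_
  rw [← Finset.sum_smul]
  congr 1
  simp [Matrix.mulVec, dotProduct, mul_comm]

theorem linearIndependent_of_det_ne_zero (Φ : V ≃ₗ[ℝ] E) {k : ℕ} {e : Fin k → E}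
    (he : Orthonormal ℂ e) {A : Matrix (Fin k) (Fin k) ℝ} (hA : A.det ≠ 0) {v : Fin k → V}
    (hv : ∀ j, Φ (v j) = ∑ i, (A i j : ℂ) • e i) : LinearIndependent ℝ v := by
  rw [Fintype.linearIndependent_iff]
  intro g hg
  have h1 : ∑ i, ((A.mulVec g i : ℝ) : ℂ) • e i = 0 := by
    rw [← map_sum_smul_eq hv, hg, map_zero]
  have h2 := Fintype.linearIndependent_iff.mp he.linearIndependent _ h1
  have h3 : A.mulVec g = 0 := funext fun i => by exact_mod_cast h2 i
  exact congrFun (Matrix.eq_zero_of_mulVec_eq_zero hA h3)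

/-- An integral basis of the intersection of `Λ` with an isotropic subspace of dimension `k`,
expressed by the real matrix `A` in the unitary family `e`. -/
structure IsIsotropicBasis (Λ : Submodule ℤ V) (Φ : V ≃ₗ[ℝ] E) {k : ℕ} (e : Fin k → E)
    (A : Matrix (Fin k) (Fin k) ℝ) (v : Fin k → V) : Prop where
  orthonormal : Orthonormal ℂ e
  mem : ∀ i, v i ∈ Λ
  expansion : ∀ j, Φ (v j) = ∑ i, (A i j : ℂ) • e i
  det_ne_zero : A.det ≠ 0
  saturated : ∀ a : Fin k → ℝ, ∑ i, a i • v i ∈ Λ → ∀ i, ∃ z : ℤ, a i = z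

/-- Passing to the saturation divides the covolume by the index, a nonzero integer, so it cannot
grow. -/
theorem IsIsotropicBasis.saturate [FiniteDimensional ℝ V] (Λ : Submodule ℤ V) [DiscreteTopology Λ]
    (Φ : V ≃ₗ[ℝ] E) {k : ℕ} {e : Fin k → E} (he : Orthonormal ℂ e)
    {A : Matrix (Fin k) (Fin k) ℝ} (hA : A.det ≠ 0) {v : Fin k → V} (hv : ∀ i, v i ∈ Λ)
    (hvA : ∀ j, Φ (v j) = ∑ i, (A i j : ℂ) • e i) :
    ∃ (A' : Matrix (Fin k) (Fin k) ℝ) (v' : Fin k → V), IsIsotropicBasis Λ Φ e A' v' ∧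
      |A'.det| ≤ |A.det| := by
  obtain ⟨u, P, -, huΛ, huP, hP, hsat⟩ :=
    exists_saturated_family Λ v (linearIndependent_of_det_ne_zero Φ he hA hvA) hv
  set Q : Matrix (Fin k) (Fin k) ℝ := P.map (Int.cast : ℤ → ℝ)
  have hQdet : Q.det = (P.det : ℝ) := by
    have := (Int.castRingHom ℝ).map_det P
    exact this.symm
  have hQ : Q.det ≠ 0 := by rw [hQdet]; exact_mod_cast hP
  have hQu : IsUnit Q.det := isUnit_iff_ne_zero.mpr hQ
  have hQ1 : 1 ≤ |Q.det| := by
    rw [hQdet]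
    exact_mod_cast Int.one_le_abs hP
  have hdet : (A * Q⁻¹).det * Q.det = A.det := by
    rw [← Matrix.det_mul, Matrix.mul_assoc, Matrix.nonsing_inv_mul _ hQu, Matrix.mul_one]
  refine ⟨A * Q⁻¹, u, ⟨he, huΛ, fun l => ?_, fun h => hA (by rw [← hdet, h, zero_mul]), hsat⟩, ?_⟩
  · have h1 : u l = ∑ j, Q⁻¹ j l • v j := by
      simp_rw [huP, Finset.smul_sum, smul_smul]
      rw [Finset.sum_comm]
      have h2 : ∀ i, ∑ j, (Q⁻¹ j l * (P i j : ℝ)) • u i = (1 : Matrix (Fin k) (Fin k) ℝ) i l • u i := by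
        intro i
        rw [← Matrix.mul_nonsing_inv _ hQu, ← Finset.sum_smul, Matrix.mul_apply]
        congr 1
        exact Finset.sum_congr rfl fun j _ => by simp [Q, mul_comm]
      simp [h2, Matrix.one_apply]
    rw [h1, map_sum]
    simp_rw [map_smul, hvA, ← Complex.coe_smul, Finset.smul_sum, smul_smul]
    rw [Finset.sum_comm]
    refine Finset.sum_congr rfl fun i _ => ?_
    rw [← Finset.sum_smul, Matrix.mul_apply]
    congr 1
    simp [mul_comm]
  · rw [← hdet, abs_mul]
    exact le_mul_of_one_le_right (abs_nonneg _) hQ1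

/-- Induction on the rank. Each step multiplies the covolume by the length of the normal component
of the new vector, at most `2nρ`, and then saturates. -/
theorem exists_isotropicBasis [FiniteDimensional ℝ V] [FiniteDimensional ℂ E]
    (Λ : Submodule ℤ V) [DiscreteTopology Λ] (Φ : V ≃ₗ[ℝ] E) {n : ℕ}
    (hn : Module.finrank ℂ E = n) (b : Module.Basis (Fin (2 * n)) ℤ Λ)
    (hint : ∀ u ∈ Λ, ∀ v ∈ Λ, ∃ z : ℤ, (⟪Φ u, Φ v⟫_ℂ).im = z)
    (hG : (Matrix.of fun i j => (⟪Φ (b i : V), Φ (b j : V)⟫_ℂ).im).det ≠ 0)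
    (ρ : ℝ) (hρ : 1 ≤ ρ)
    (hGρ : |(Matrix.of fun i j => (⟪Φ (b i : V), Φ (b j : V)⟫_ℂ).im).det| < ρ ^ 2)
    (k : ℕ) (hk : k ≤ n) :
    ∃ (e : Fin k → E) (A : Matrix (Fin k) (Fin k) ℝ) (v : Fin k → V),
      IsIsotropicBasis Λ Φ e A v ∧ |A.det| ≤ (2 * n * ρ) ^ k := by
  induction k with
  | zero =>
    refine ⟨Fin.elim0, 1, Fin.elim0, ⟨⟨fun i => i.elim0, fun i => i.elim0⟩, fun i => i.elim0,
      fun i => i.elim0, by simp, fun _ _ i => i.elim0⟩, by simp⟩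
  | succ k ih =>
    obtain ⟨e, A, v, h, hdet⟩ := ih (by omega)
    obtain ⟨m, rfl⟩ := Nat.exists_eq_add_of_le (show k ≤ n by omega)
    obtain ⟨f, hf⟩ : ∃ f : OrthonormalBasis (Fin k ⊕ Fin m) ℂ E, ∀ i, f (Sum.inl i) = e i := by
      obtain ⟨f, hf⟩ := Orthonormal.exists_orthonormalBasis_extension_of_card_eq (𝕜 := ℂ)
        (ι := Fin k ⊕ Fin m) (by simp [hn]) (v := Sum.elim e 0) (s := Set.range Sum.inl) (by
          constructor
          · rintro ⟨_, i, rfl⟩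
            exact h.orthonormal.1 i
          · rintro ⟨_, i, rfl⟩ ⟨_, j, rfl⟩ hij
            exact h.orthonormal.2 fun h => hij (by rw [h]))
      exact ⟨f, fun i => hf _ ⟨i, rfl⟩⟩
    let ε : Fin (2 * (k + m)) ≃ (Fin k ⊕ Fin m) ⊕ (Fin k ⊕ Fin m) :=
      Fintype.equivOfCardEq (by simp; ring)
    set X := coordMatrix f fun j => Φ ((b.reindex ε) j : V)
    have hX : X.det ^ 2 = |(Matrix.of fun i j => (⟪Φ (b i : V), Φ (b j : V)⟫_ℂ).im).det| := by
      rw [sq_det_coordMatrix, ← Matrix.det_submatrix_equiv_self ε.symm (Matrix.of _)]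
      congr 3
      ext i j
      simp
    obtain ⟨x, hxΛ, a, w, hx, hw0, hw, hwn⟩ := exists_lattice_vector Φ (show 0 < m by omega)
      (b.reindex ε) hint f A h.det_ne_zero v h.mem (by simpa [hf] using h.expansion) h.saturated ρ
      hρ (fun h0 => hG (abs_eq_zero.mp (by rw [← hX, show X.det = 0 from h0]; simp)))
      (abs_lt_of_sq_lt_sq (hX.trans_lt hGρ) (by linarith))
    have hwpos : 0 < ‖w‖ := norm_pos_iff.mpr hw0
    -- One Gram–Schmidt step: the new unit vector is `w / ‖w‖`, and the basis matrix becomes block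
    -- triangular with new diagonal entry `‖w‖`. Its real entries keep the enlarged family
    -- isotropic.
    let e' : Fin k ⊕ Fin 1 → E := Sum.elim e fun _ => ((‖w‖⁻¹ : ℝ) : ℂ) • w
    let A' : Matrix (Fin k ⊕ Fin 1) (Fin k ⊕ Fin 1) ℝ :=
      Matrix.fromBlocks A (Matrix.of fun i _ => A.mulVec a i) 0 (Matrix.of fun _ _ => ‖w‖)
    let v' : Fin k ⊕ Fin 1 → V := Sum.elim v fun _ => x
    let φ := (finSumFinEquiv (m := k) (n := 1)).symm
    have he' : Orthonormal ℂ e' := by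
      have hew : ∀ i, ⟪e i, w⟫_ℂ = 0 := fun i => hf i ▸ hw i
      constructor
      · rintro (i | i)
        · exact h.orthonormal.1 i
        · simp [e', norm_smul, hwpos.ne']
      · rintro (i | i) (j | j) hij
        · exact h.orthonormal.2 fun h => hij (by rw [h])
        · simp only [e', Sum.elim_inl, Sum.elim_inr, inner_smul_right, hew, mul_zero]
        · simp only [e', Sum.elim_inl, Sum.elim_inr, inner_smul_left,
            inner_eq_zero_symm.mp (hew j), mul_zero]
        · exact absurd (by rw [Subsingleton.elim i j]) hij
    have hA' : A'.det = A.det * ‖w‖ := by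
      simp [A', Matrix.det_fromBlocks_zero₂₁]
    have hvA' : ∀ j, Φ (v' j) = ∑ i, (A' i j : ℂ) • e' i := by
      rintro (j | j)
      · simp [v', A', e', h.expansion]
      · simp only [v', A', e', Fintype.sum_sum_type, Sum.elim_inl, Sum.elim_inr, hx,
          Matrix.fromBlocks_apply₁₂, Matrix.fromBlocks_apply₂₂, Matrix.of_apply, h.expansion,
          Finset.univ_unique, Finset.sum_singleton, smul_smul, Finset.smul_sum]
        congr 1
        · rw [Finset.sum_comm]
          refine Finset.sum_congr rfl fun i _ => ?_
          rw [← Finset.sum_smul]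
          congr 1
          simp [Matrix.mulVec, dotProduct, mul_comm]
        · rw [← Complex.ofReal_mul, mul_inv_cancel₀ hwpos.ne', Complex.ofReal_one, one_smul]
    have hAφ : (A'.submatrix φ φ).det = A'.det := Matrix.det_submatrix_equiv_self φ A'
    obtain ⟨B, u, hB, hBdet⟩ := IsIsotropicBasis.saturate Λ Φ (e := e' ∘ φ) (v := v' ∘ φ)
      (A := A'.submatrix φ φ) (he'.comp _ φ.injective)
      (by rw [hAφ, hA']; exact mul_ne_zero h.det_ne_zero hwpos.ne')
      (by
        intro i
        rcases hi : φ i with j | j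
        · simpa [hi, v'] using h.mem j
        · simpa [hi, v'] using hxΛ)
      (fun j => (hvA' (φ j)).trans (φ.sum_comp fun i => (A' i (φ j) : ℂ) • e' i).symm)
    refine ⟨_, B, u, hB, hBdet.trans ?_⟩
    rw [hAφ, hA', abs_mul, abs_of_pos hwpos, pow_succ]
    refine mul_le_mul hdet (hwn.trans ?_) hwpos.le (by positivity)
    push_cast
    nlinarith [Nat.cast_nonneg (α := ℝ) k]

end Isotropic

/-! ### Linear Lagrangian tori as compact special Lagrangian submanifolds -/

section LinearTorus

open MeasureTheory

variable {V : Type*} [NormedAddCommGroup V] [NormedSpace ℝ V]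

/-- The linear parametrisation `u ↦ ∑ uᵢ vᵢ`. -/
noncomputable def linParam {n : ℕ} (v : Fin n → V) : (Fin n → ℝ) →L[ℝ] V :=
  (Fintype.linearCombination ℝ v).toContinuousLinearMap

theorem linParam_apply {n : ℕ} (v : Fin n → V) (u : Fin n → ℝ) :
    linParam v u = ∑ i, u i • v i := rfl

theorem frame_linParam {n : ℕ} (v : Fin n → V) (u : Fin n → ℝ) : frame (linParam v) u = v := by
  funext i
  simp [frame, (linParam v).fderiv, linParam_apply, Pi.single_apply]

theorem range_linParam {n : ℕ} (v : Fin n → V) :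
    LinearMap.range (linParam v).toLinearMap = Submodule.span ℝ (Set.range v) :=
  Fintype.range_linearCombination ℝ v

theorem linParam_injective {n : ℕ} {v : Fin n → V} (hv : LinearIndependent ℝ v) :
    Function.Injective (linParam v) :=
  (injective_iff_map_eq_zero (linParam v)).mpr fun u hu =>
    funext (Fintype.linearIndependent_iff.mp hv u hu)

/-- The map `u ↦ ∑ uᵢ vᵢ` to the torus. -/
noncomputable def torusParam {n : ℕ} (Λ : Submodule ℤ V) (v : Fin n → V) (u : Fin n → ℝ) :
    V ⧸ Λ :=
  Submodule.Quotient.mk (linParam v u)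

theorem continuous_torusParam {n : ℕ} (Λ : Submodule ℤ V) (v : Fin n → V) :
    Continuous (torusParam Λ v) :=
  continuous_quot_mk.comp (linParam v).continuous

variable {Λ : Submodule ℤ V} {n : ℕ} {v : Fin n → V}

theorem torusParam_eq_iff (hmem : ∀ i, v i ∈ Λ)
    (hsat : ∀ a : Fin n → ℝ, ∑ i, a i • v i ∈ Λ → ∀ i, ∃ z : ℤ, a i = z) {u u' : Fin n → ℝ} :
    torusParam Λ v u = torusParam Λ v u' ↔ ∀ i, ∃ z : ℤ, u i - u' i = z := by
  rw [torusParam, torusParam, Submodule.Quotient.eq, ← map_sub, linParam_apply]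
  refine ⟨hsat _, fun h => Submodule.sum_mem _ fun i _ => ?_⟩
  obtain ⟨z, hz⟩ := h i
  rw [Pi.sub_apply, hz, Int.cast_smul_eq_zsmul]
  exact Λ.smul_mem z (hmem i)

theorem eq_of_torusParam_eq (hmem : ∀ i, v i ∈ Λ)
    (hsat : ∀ a : Fin n → ℝ, ∑ i, a i • v i ∈ Λ → ∀ i, ∃ z : ℤ, a i = z) {u u' : Fin n → ℝ}
    (h : torusParam Λ v u = torusParam Λ v u') (hd : ∀ i, |u i - u' i| < 1) : u = u' := by
  funext i
  obtain ⟨z, hz⟩ := (torusParam_eq_iff hmem hsat).mp h i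
  have h1 := hd i
  rw [hz] at h1
  have : |z| < 1 := by exact_mod_cast h1
  rw [Int.abs_lt_one_iff.mp this, Int.cast_zero] at hz
  linarith

theorem range_torusParam_eq_image (hmem : ∀ i, v i ∈ Λ)
    (hsat : ∀ a : Fin n → ℝ, ∑ i, a i • v i ∈ Λ → ∀ i, ∃ z : ℤ, a i = z) (c : Fin n → ℝ) :
    Set.range (torusParam Λ v) =
      torusParam Λ v '' Set.univ.pi fun i => Set.Ico (c i) (c i + 1) := by
  refine Set.Subset.antisymm ?_ (Set.image_subset_range _ _)
  rintro _ ⟨u, rfl⟩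
  refine ⟨fun i => c i + Int.fract (u i - c i), fun i _ => ⟨?_, ?_⟩, ?_⟩
  · linarith [Int.fract_nonneg (u i - c i)]
  · linarith [Int.fract_lt_one (u i - c i)]
  · rw [torusParam_eq_iff hmem hsat]
    exact fun i => ⟨-⌊u i - c i⌋, by rw [← Int.self_sub_floor]; push_cast; ring⟩

theorem isCompact_range_torusParam (hmem : ∀ i, v i ∈ Λ)
    (hsat : ∀ a : Fin n → ℝ, ∑ i, a i • v i ∈ Λ → ∀ i, ∃ z : ℤ, a i = z) :
    IsCompact (Set.range (torusParam Λ v)) := by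
  have : Set.range (torusParam Λ v) = torusParam Λ v '' Set.Icc 0 1 := by
    refine Set.Subset.antisymm ?_ (Set.image_subset_range _ _)
    rw [range_torusParam_eq_image hmem hsat 0]
    refine Set.image_mono fun u hu => ⟨fun i => (hu i trivial).1, fun i => ?_⟩
    simpa using (hu i trivial).2.le
  rw [this]
  exact isCompact_Icc.image (continuous_torusParam Λ v)

theorem isLocalParam_linParam [DiscreteTopology Λ] (hv : LinearIndependent ℝ v)
    (hmem : ∀ i, v i ∈ Λ)
    (hsat : ∀ a : Fin n → ℝ, ∑ i, a i • v i ∈ Λ → ∀ i, ∃ z : ℤ, a i = z) (c : Fin n → ℝ) :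
    IsLocalParam Λ (Set.range (torusParam Λ v)) (Metric.ball c (1 / 3)) (linParam v) := by
  -- Closedness of `Λ` makes `V ⧸ Λ` Hausdorff, as needed for the closed embedding and for the
  -- closedness of compact images below.
  have hclosed : IsClosed (Λ : Set V) :=
    AddSubgroup.isClosed_of_discrete (H := Λ.toAddSubgroup)
  have hdist : ∀ {u u' : Fin n → ℝ} {r : ℝ}, dist u u' < r → ∀ i, |u i - u' i| < r := by
    intro u u' r h i
    rw [← Real.dist_eq]
    exact (dist_le_pi_dist u u' i).trans_lt h
  refine ⟨Metric.isOpen_ball, (linParam v).contDiff.contDiffOn, fun u _ => ?_, ?_, ?_⟩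
  · rw [(linParam v).fderiv]
    exact linParam_injective hv
  · have hcl : Topology.IsClosedEmbedding
        -- Two points of this ball differ by at most `2/3 < 1` in each coordinate, so they cannot
        -- differ by a nonzero integer vector.
        (fun u : Metric.closedBall c (1 / 3) => torusParam Λ v u) := by
      have : CompactSpace (Metric.closedBall c (1 / 3)) :=
        isCompact_iff_compactSpace.mp (isCompact_closedBall c (1 / 3))
      refine Continuous.isClosedEmbedding
        ((continuous_torusParam Λ v).comp continuous_subtype_val) ?_
      rintro ⟨u, hu⟩ ⟨u', hu'⟩ h
      refine Subtype.ext (eq_of_torusParam_eq hmem hsat h (hdist ?_))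
      calc dist u u' ≤ dist u c + dist u' c := dist_triangle_right _ _ _
        _ ≤ 1 / 3 + 1 / 3 := add_le_add hu hu'
        _ < 1 := by norm_num
    exact hcl.isEmbedding.comp
      (Topology.IsEmbedding.inclusion (Metric.ball_subset_closedBall (x := c) (ε := 1 / 3)))
  -- In the sup norm the closed ball of radius `1/2` contains a fundamental cube. The part outside
  -- the chart is compact, and its image misses that of the chart because `1/2 + 1/3 < 1`; the
  -- complement of this image is the required open set.
  · set K : Set (Fin n → ℝ) := Metric.closedBall c (1 / 2) \ Metric.ball c (1 / 3)
    have hK : IsCompact K := (isCompact_closedBall c (1 / 2)).diff Metric.isOpen_ball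
    refine ⟨(torusParam Λ v '' K)ᶜ,
      (hK.image (continuous_torusParam Λ v)).isClosed.isOpen_compl, ?_⟩
    refine Set.Subset.antisymm ?_ ?_
    · rintro _ ⟨u, hu, rfl⟩
      refine ⟨⟨u, rfl⟩, ?_⟩
      rintro ⟨u', hu', h⟩
      have : u' = u := by
        refine eq_of_torusParam_eq hmem hsat h (hdist ?_)
        calc dist u' u ≤ dist u' c + dist u c := dist_triangle_right _ _ _
          _ < 1 / 2 + 1 / 3 := add_lt_add_of_le_of_lt hu'.1 hu
          _ < 1 := by norm_num
      exact hu'.2 (this ▸ hu)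
    · rintro _ ⟨hp, hpK⟩
      rw [range_torusParam_eq_image hmem hsat fun i => c i - 1 / 2] at hp
      obtain ⟨u, hu, rfl⟩ := hp
      refine ⟨u, ?_, rfl⟩
      by_contra hub
      refine hpK ⟨u, ⟨?_, hub⟩, rfl⟩
      rw [Metric.mem_closedBall, dist_pi_le_iff (by norm_num)]
      intro i
      have := hu i trivial
      rw [Real.dist_eq, abs_le]
      constructor <;> linarith [this.1, this.2]

/-- The linear parametrisation has constant frame `v`, so tangent space and phase are constant. -/
theorem isCompactSpecialLagrangian_range [DiscreteTopology Λ] {ω : V [⋀^Fin 2]→ₗ[ℝ] ℝ}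
    {Ω : V [⋀^Fin n]→ₗ[ℝ] ℂ} (hv : LinearIndependent ℝ v) (hmem : ∀ i, v i ∈ Λ)
    (hsat : ∀ a : Fin n → ℝ, ∑ i, a i • v i ∈ Λ → ∀ i, ∃ z : ℤ, a i = z)
    (hlag : IsLagrangian ω (Submodule.span ℝ (Set.range v))) (hΩ : Ω v ≠ 0) :
    IsCompactSpecialLagrangian ω Λ Ω (Ω v).arg (Set.range (torusParam Λ v)) := by
  refine ⟨Set.range_nonempty _, isCompact_range_torusParam hmem hsat, ?_⟩
  rintro _ ⟨c, rfl⟩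
  refine ⟨_, linParam v, isLocalParam_linParam hv hmem hsat c,
    ⟨c, Metric.mem_ball_self (by norm_num), rfl⟩, fun u _ => ⟨?_, ‖Ω v‖, by simpa using hΩ, ?_⟩⟩
  · rw [(linParam v).fderiv, range_linParam]
    exact hlag
  · rw [frame_linParam, Complex.norm_mul_exp_arg_mul_I]

theorem densityIntegral_range_le (Ω : V [⋀^Fin n]→ₗ[ℝ] ℂ) (hmem : ∀ i, v i ∈ Λ)
    (hsat : ∀ a : Fin n → ℝ, ∑ i, a i • v i ∈ Λ → ∀ i, ∃ z : ℤ, a i = z) :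
    densityIntegral Λ Ω (Set.range (torusParam Λ v)) ≤ ‖Ω v‖ₑ := by
  set Q : Set (Fin n → ℝ) := Set.univ.pi fun _ => Set.Ico 0 1
  -- The half-open unit cube already covers the torus injectively; all other pieces are empty.
  set A : ℕ → Set (Fin n → ℝ) := fun k => if k = 0 then Q else ∅
  have hcut : IsCutting Λ (Set.range (torusParam Λ v)) (fun _ => Set.univ) A
      (fun _ => linParam v) := by
    refine ⟨fun _ => isOpen_univ, fun _ => (linParam v).contDiff.contDiffOn,
      fun _ u _ => ⟨u, rfl⟩, fun _ => Set.subset_univ _, fun k => ?_, fun k => ?_, fun k l hkl => ?_,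
      ?_⟩
    · simp only [A]
      split_ifs
      · exact MeasurableSet.univ_pi fun _ => measurableSet_Ico
      · exact MeasurableSet.empty
    · simp only [A]
      split_ifs
      · intro u hu u' hu' h
        refine eq_of_torusParam_eq hmem hsat h fun i => ?_
        have h1 := hu i trivial
        have h2 := hu' i trivial
        rw [abs_lt]
        constructor <;> linarith [h1.1, h1.2, h2.1, h2.2]
      · exact Set.injOn_empty _
    · simp only [A]
      split_ifs with h1 h2
      · exact absurd (h1.trans h2.symm) hkl
      all_goals simp
    · have h := range_torusParam_eq_image hmem hsat 0
      simp only [Pi.zero_apply, zero_add] at h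
      refine Set.Subset.antisymm (Set.iUnion_subset fun k => ?_) ?_
      · exact Set.image_subset_range (torusParam Λ v) _
      · rw [h]
        exact Set.subset_iUnion_of_subset 0 (by simp only [A, if_true]; exact subset_rfl)
  refine (iInf₂_le_of_le _ A (iInf₂_le_of_le _ hcut ?_))
  rw [tsum_eq_single 0 (fun k hk => by simp [A, hk])]
  simp only [frame_linParam, A, if_true, lintegral_const, Measure.restrict_apply MeasurableSet.univ,
    Set.univ_inter, Q, Real.volume_pi_Ico]
  simp

theorem Sys_le [DiscreteTopology Λ] {ω : V [⋀^Fin 2]→ₗ[ℝ] ℝ} {Ω : V [⋀^Fin n]→ₗ[ℝ] ℂ}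
    (hv : LinearIndependent ℝ v) (hmem : ∀ i, v i ∈ Λ)
    (hsat : ∀ a : Fin n → ℝ, ∑ i, a i • v i ∈ Λ → ∀ i, ∃ z : ℤ, a i = z)
    (hlag : IsLagrangian ω (Submodule.span ℝ (Set.range v))) (hΩ : Ω v ≠ 0) :
    Sys ω Λ Ω ≤ ‖Ω v‖ₑ :=
  iInf₂_le_of_le _ ⟨_, isCompactSpecialLagrangian_range hv hmem hsat hlag hΩ⟩
    (densityIntegral_range_le Ω hmem hsat)

end LinearTorus

/-! ### Two-forms as bilinear maps -/

section Bilinear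

variable {V : Type*} [AddCommGroup V] [Module ℝ V]

theorem twoForm_swap (ω : V [⋀^Fin 2]→ₗ[ℝ] ℝ) (x y : V) : ω ![x, y] = -ω ![y, x] := by
  have := ω.map_swap ![y, x] (i := 0) (j := 1) (by decide)
  rw [← this]
  congr 1
  funext i
  fin_cases i <;> rfl

/-- A two-form as a bilinear map. -/
noncomputable def toBilin (ω : V [⋀^Fin 2]→ₗ[ℝ] ℝ) : V →ₗ[ℝ] V →ₗ[ℝ] ℝ :=
  LinearMap.mk₂ ℝ (fun x y => ω ![x, y])
    (fun x x' y => ω.map_vecCons_add ![y] x x')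
    (fun c x y => ω.map_vecCons_smul ![y] c x)
    (fun x y y' => by
      have := ω.map_vecCons_add ![x] y y'
      rw [twoForm_swap, this, twoForm_swap ω x y, twoForm_swap ω x y', neg_add])
    (fun c x y => by
      have := ω.map_vecCons_smul ![x] c y
      rw [twoForm_swap, this, twoForm_swap ω x y, smul_neg])

theorem toBilin_apply (ω : V [⋀^Fin 2]→ₗ[ℝ] ℝ) (x y : V) : toBilin ω x y = ω ![x, y] := rfl

end Bilinear

/-! ### The Hermitian structure of a compatible complex structure -/

section Unitary

open scoped InnerProductSpace

variable {V : Type*} [AddCommGroup V] [Module ℝ V]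

/-- The product `ω(x, Jy) + i ω(x, y)` is Hermitian, conjugate linear in the first variable, and
positive by compatibility; an orthonormal basis gives `Φ`. Here `V` carries no norm of its own, so
the Hermitian norm conflicts with nothing. -/
theorem exists_unitary_equiv [FiniteDimensional ℝ V] {n : ℕ} (hdim : Module.finrank ℝ V = 2 * n)
    {ω : V [⋀^Fin 2]→ₗ[ℝ] ℝ} {J : V →ₗ[ℝ] V} (hJ : IsCompatible ω J) :
    ∃ Φ : V ≃ₗ[ℝ] EuclideanSpace ℂ (Fin n), (∀ x y, (⟪Φ x, Φ y⟫_ℂ).im = ω ![x, y]) ∧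
      ∀ x, Φ (J x) = Complex.I • Φ x := by
  have hadd : ∀ x y z, ω ![x + y, z] = ω ![x, z] + ω ![y, z] := (toBilin ω).map_add₂
  have hsmul : ∀ (c : ℝ) x z, ω ![c • x, z] = c * ω ![x, z] := (toBilin ω).map_smul₂
  have hadd' : ∀ x y z, ω ![x, y + z] = ω ![x, y] + ω ![x, z] := fun x => (toBilin ω x).map_add
  have hsmul' : ∀ (c : ℝ) x z, ω ![x, c • z] = c * ω ![x, z] := fun c x z =>
    (toBilin ω x).map_smul c z
  have hneg' : ∀ x z, ω ![x, -z] = -ω ![x, z] := fun x => (toBilin ω x).map_neg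
  have hJs : ∀ x y, ω ![J x, y] = -ω ![x, J y] := by
    intro x y
    rw [← hJ.invariant x (J y), hJ.sq, hneg', neg_neg]
  let _ : Module ℂ V :=
    { smul := fun c x => c.re • x + c.im • J x
      one_smul := fun x => by
        change (1 : ℂ).re • x + (1 : ℂ).im • J x = x
        simp
      mul_smul := fun c d x => by
        change (c * d).re • x + (c * d).im • J x =
          c.re • (d.re • x + d.im • J x) + c.im • J (d.re • x + d.im • J x)
        simp only [map_add, map_smul, hJ.sq, Complex.mul_re, Complex.mul_im]
        module
      smul_zero := fun c => by
        change c.re • (0 : V) + c.im • J 0 = 0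
        simp
      smul_add := fun c x y => by
        change c.re • (x + y) + c.im • J (x + y) = (c.re • x + c.im • J x) + (c.re • y + c.im • J y)
        rw [map_add]
        module
      add_smul := fun c d x => by
        change (c + d).re • x + (c + d).im • J x = (c.re • x + c.im • J x) + (d.re • x + d.im • J x)
        simp only [Complex.add_re, Complex.add_im]
        module
      zero_smul := fun x => by
        change (0 : ℂ).re • x + (0 : ℂ).im • J x = 0
        simp }
  have hdef : ∀ (c : ℂ) (x : V), c • x = c.re • x + c.im • J x := fun _ _ => rfl
  have htower : IsScalarTower ℝ ℂ V := ⟨fun r c x => by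
    simp only [hdef, Complex.smul_re, Complex.smul_im, smul_eq_mul]
    module⟩
  let core : InnerProductSpace.Core ℂ V :=
    { inner := fun x y => ⟨ω ![x, J y], ω ![x, y]⟩
      conj_inner_symm := fun x y => by
        apply Complex.ext
        · change ω ![y, J x] = ω ![x, J y]
          rw [twoForm_swap, hJs, neg_neg]
        · change -ω ![y, x] = ω ![x, y]
          rw [twoForm_swap ω x y]
      re_inner_nonneg := fun x => by
        change 0 ≤ ω ![x, J x]
        rcases eq_or_ne x 0 with rfl | hx
        · exact (hsmul 0 0 (J 0) |>.symm.trans (by simp)).le.trans' (by simp)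
        · exact (hJ.pos x hx).le
      add_left := fun x y z => by
        apply Complex.ext
        · exact hadd x y (J z)
        · exact hadd x y z
      smul_left := fun x y c => by
        apply Complex.ext
        · change ω ![c • x, J y] = _
          simp only [hdef, hadd, hsmul, hJs, hJ.sq, hneg', Complex.mul_re, Complex.conj_re,
            Complex.conj_im]
          ring
        · change ω ![c • x, y] = _
          simp only [hdef, hadd, hsmul, hJs, Complex.mul_im, Complex.conj_re, Complex.conj_im]
          ring
      definite := fun x hx => by
        by_contra h
        exact (hJ.pos x h).ne' (congrArg Complex.re hx) }
  let _ : NormedAddCommGroup V := core.toNormedAddCommGroup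
  let _ : InnerProductSpace ℂ V := InnerProductSpace.ofCore core.toCore
  have hfin : FiniteDimensional ℂ V := FiniteDimensional.right ℝ ℂ V
  have hrank : Module.finrank ℂ V = n := by
    have := Module.finrank_mul_finrank ℝ ℂ V
    rw [Complex.finrank_real_complex, hdim] at this
    omega
  let f : OrthonormalBasis (Fin n) ℂ V := (stdOrthonormalBasis ℂ V).reindex (finCongr hrank)
  refine ⟨f.repr.toLinearEquiv.restrictScalars ℝ, fun x y => ?_, fun x => ?_⟩
  · exact congrArg Complex.im (f.repr.inner_map_map x y)
  · have : J x = Complex.I • x := by simp [hdef]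
    rw [this]
    exact f.repr.map_smul Complex.I x

end Unitary

/-! ### Forms in unitary coordinates -/

section Coordinates

open scoped InnerProductSpace

variable {E : Type*} [NormedAddCommGroup E] [InnerProductSpace ℂ E]
  {V : Type*} [AddCommGroup V] [Module ℝ V] {n : ℕ}

/-- The real part of the `i`-th unitary coordinate. -/
noncomputable def reCoord (Φ : V ≃ₗ[ℝ] E) (e : OrthonormalBasis (Fin n) ℂ E) (i : Fin n) :
    V →ₗ[ℝ] ℝ :=
  Complex.reLm ∘ₗ ((innerSL ℂ (e i)).toLinearMap.restrictScalars ℝ) ∘ₗ Φ.toLinearMap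

/-- The imaginary part of the `i`-th unitary coordinate. -/
noncomputable def imCoord (Φ : V ≃ₗ[ℝ] E) (e : OrthonormalBasis (Fin n) ℂ E) (i : Fin n) :
    V →ₗ[ℝ] ℝ :=
  Complex.imLm ∘ₗ ((innerSL ℂ (e i)).toLinearMap.restrictScalars ℝ) ∘ₗ Φ.toLinearMap

theorem reCoord_apply (Φ : V ≃ₗ[ℝ] E) (e : OrthonormalBasis (Fin n) ℂ E) (i : Fin n) (x : V) :
    reCoord Φ e i x = (⟪e i, Φ x⟫_ℂ).re := rfl

theorem imCoord_apply (Φ : V ≃ₗ[ℝ] E) (e : OrthonormalBasis (Fin n) ℂ E) (i : Fin n) (x : V) :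
    imCoord Φ e i x = (⟪e i, Φ x⟫_ℂ).im := rfl

theorem eq_sum_detForm_coord {ω : V [⋀^Fin 2]→ₗ[ℝ] ℝ} {Φ : V ≃ₗ[ℝ] E}
    (hΦ : ∀ x y, (⟪Φ x, Φ y⟫_ℂ).im = ω ![x, y]) (e : OrthonormalBasis (Fin n) ℂ E) :
    ω = ∑ i, detForm ![reCoord Φ e i, imCoord Φ e i] := by
  ext v
  have hv : v = ![v 0, v 1] := by
    funext i
    fin_cases i <;> rfl
  rw [sum_alternatingMap_apply, hv, ← hΦ, ← e.sum_inner_mul_inner, Complex.im_sum]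
  refine Finset.sum_congr rfl fun i _ => ?_
  have hre : (⟪Φ (v 0), e i⟫_ℂ).re = (⟪e i, Φ (v 0)⟫_ℂ).re := inner_re_symm (𝕜 := ℂ) _ _
  have him : (⟪Φ (v 0), e i⟫_ℂ).im = -(⟪e i, Φ (v 0)⟫_ℂ).im := inner_im_symm (𝕜 := ℂ) _ _
  rw [detForm_apply, Matrix.det_fin_two, Complex.mul_im, hre, him]
  simp [reCoord_apply, imCoord_apply]
  ring

/-- Type `(n,0)` means that `Ω`, transported to `E`, is an alternating `n`-form over `ℂ`; such forms
on an `n`-dimensional complex space are multiples of the determinant. -/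
theorem exists_eq_smul_detForm {Ω : V [⋀^Fin n]→ₗ[ℝ] ℂ} {J : V →ₗ[ℝ] V} (hΩ : IsTypeTop J Ω)
    {Φ : V ≃ₗ[ℝ] E} (hJ : ∀ x, Φ (J x) = Complex.I • Φ x) (e : OrthonormalBasis (Fin n) ℂ E) :
    ∃ c : ℂ, Ω = c • detForm fun i => complexCoord (reCoord Φ e i) (imCoord Φ e i) := by
  have hJ' : ∀ (c : ℂ) (w : E), Φ.symm (c • w) = c.re • Φ.symm w + c.im • J (Φ.symm w) := by
    intro c w
    apply Φ.injective
    rw [Φ.apply_symm_apply, map_add, map_smul, map_smul, hJ, Φ.apply_symm_apply]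
    conv_lhs => rw [← Complex.re_add_im c, add_smul, mul_smul]
    simp only [Complex.coe_smul]
  let Ψ : E [⋀^Fin n]→ₗ[ℂ] ℂ :=
    { toFun := fun w => Ω (Φ.symm ∘ w)
      map_update_add' := fun w i x y => by
        rename_i inst
        have : inst = instDecidableEqFin n := Subsingleton.elim _ _
        subst this
        simp only [Function.comp_update, map_add, Ω.map_update_add]
      map_update_smul' := fun w i c x => by
        rename_i inst
        have : inst = instDecidableEqFin n := Subsingleton.elim _ _
        subst this
        simp only [Function.comp_update]
        have h := hΩ (Function.update (Φ.symm ∘ w) i (Φ.symm x)) i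
        rw [Function.update_self, Function.update_idem] at h
        rw [hJ', Ω.map_update_add, Ω.map_update_smul, Ω.map_update_smul, h]
        simp only [Complex.real_smul, smul_eq_mul]
        conv_rhs => rw [← Complex.re_add_im c]
        ring
      map_eq_zero_of_eq' := fun w i j h hij =>
        Ω.map_eq_zero_of_eq _ (by simp [h]) hij }
  refine ⟨Ψ e, ?_⟩
  ext v
  have h1 : Ω v = Ψ (fun j => Φ (v j)) := by
    change Ω v = Ω (Φ.symm ∘ fun j => Φ (v j))
    congr 1
    funext j
    simp
  have hΨ : ∀ w, Ψ w = Ψ e * e.toBasis.det w := by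
    intro w
    conv_lhs => rw [Ψ.eq_smul_basis_det e.toBasis]
    simp
  rw [h1, hΨ, AlternatingMap.smul_apply, detForm_apply, Module.Basis.det_apply, ← Matrix.det_transpose]
  simp only [smul_eq_mul]
  congr 2
  ext i j
  simp [Module.Basis.toMatrix_apply, complexCoord_apply, reCoord_apply, imCoord_apply,
    e.repr_apply_apply]
  rw [mul_comm, Complex.re_add_im]

theorem detForm_interleave_coord_ne_zero (Φ : V ≃ₗ[ℝ] E)
    (e : OrthonormalBasis (Fin n) ℂ E) {v : Fin (2 * n) → V} (hv : LinearIndependent ℝ v) :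
    detForm (interleave (reCoord Φ e) (imCoord Φ e) id) v ≠ 0 := by
  intro h0
  rw [detForm_apply] at h0
  obtain ⟨c, hc, hc0⟩ := Matrix.exists_vecMul_eq_zero_iff.mpr h0
  have hz : ∀ p : Fin n × Fin 2, interleave (reCoord Φ e) (imCoord Φ e) id (pairEquiv n p)
      (∑ i, c i • v i) = 0 := by
    intro p
    have := congrFun hc0 (pairEquiv n p)
    simpa [Matrix.vecMul, dotProduct] using this
  have hu : ∑ i, c i • v i = 0 := by
    apply Φ.injective
    rw [map_zero, ← e.sum_repr' (Φ _)]
    refine Finset.sum_eq_zero fun i _ => ?_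
    have h1 := hz (i, 0)
    have h2 := hz (i, 1)
    rw [interleave_pairEquiv] at h1 h2
    simp only [if_true, one_ne_zero, if_false, id, reCoord_apply, imCoord_apply] at h1 h2
    have h3 : ⟪e i, Φ (∑ i, c i • v i)⟫_ℂ = 0 := Complex.ext h1 h2
    rw [h3, zero_smul]
  exact hc (funext (Fintype.linearIndependent_iff.mp hv c hu))

end Coordinates

/-! ### Integrality, nondegeneracy and orientation on the lattice -/

section Lattice

variable {V : Type*} [AddCommGroup V] [Module ℝ V]

/-- The product of the denominators of the Gram matrix of a `ℤ`-basis works, by bilinearity. -/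
theorem exists_integral_multiple {ω : V [⋀^Fin 2]→ₗ[ℝ] ℝ} {Λ : Submodule ℤ V}
    (hrat : IsRationalOn ω Λ) {ι : Type*} [Fintype ι] (b : Module.Basis ι ℤ Λ) :
    ∃ N : ℕ, 0 < N ∧ ∀ x ∈ Λ, ∀ y ∈ Λ, ∃ z : ℤ, (N : ℝ) * ω ![x, y] = z := by
  choose q hq using fun i j => hrat (b i) (b i).2 (b j) (b j).2
  refine ⟨∏ p : ι × ι, (q p.1 p.2).den, Finset.prod_pos fun p _ => (q p.1 p.2).den_pos, ?_⟩
  set N := ∏ p : ι × ι, (q p.1 p.2).den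
  have hb : ∀ i j, ∃ z : ℤ, (N : ℝ) * ω ![(b i : V), (b j : V)] = z := by
    intro i j
    obtain ⟨d, hd⟩ : (q i j).den ∣ N :=
      Finset.dvd_prod_of_mem (fun p : ι × ι => (q p.1 p.2).den) (Finset.mem_univ (i, j))
    refine ⟨d * (q i j).num, ?_⟩
    rw [hq, hd]
    have : ((q i j : ℚ) : ℝ) * ((q i j).den : ℝ) = ((q i j).num : ℝ) := by
      exact_mod_cast congrArg (fun r : ℚ => (r : ℝ)) (Rat.mul_den_eq_num (q i j))
    push_cast
    rw [← this]
    ring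
  choose z hz using hb
  intro x hx y hy
  refine ⟨∑ i, ∑ j, b.repr ⟨x, hx⟩ i * b.repr ⟨y, hy⟩ j * z i j, ?_⟩
  have hx' : x = ∑ i, (b.repr ⟨x, hx⟩ i : ℝ) • (b i : V) := by
    have := congrArg Subtype.val (b.sum_repr ⟨x, hx⟩)
    rw [Submodule.coe_sum] at this
    simpa only [Int.cast_smul_eq_zsmul, Submodule.coe_smul] using this.symm
  have hy' : y = ∑ i, (b.repr ⟨y, hy⟩ i : ℝ) • (b i : V) := by
    have := congrArg Subtype.val (b.sum_repr ⟨y, hy⟩)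
    rw [Submodule.coe_sum] at this
    simpa only [Int.cast_smul_eq_zsmul, Submodule.coe_smul] using this.symm
  rw [← toBilin_apply]
  conv_lhs => rw [hx', hy']
  simp only [map_sum, map_smul, LinearMap.sum_apply, LinearMap.smul_apply, smul_eq_mul,
    toBilin_apply, Int.cast_sum, Int.cast_mul, ← hz, Finset.mul_sum]
  rw [Finset.sum_comm]
  exact Finset.sum_congr rfl fun i _ => Finset.sum_congr rfl fun j _ => by ring

theorem det_gram_ne_zero {ω : V [⋀^Fin 2]→ₗ[ℝ] ℝ} (hω : IsSymplectic ω) {ι : Type*} [Fintype ι]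
    [DecidableEq ι] (b : Module.Basis ι ℝ V) : (Matrix.of fun i j => ω ![b i, b j]).det ≠ 0 := by
  intro h0
  obtain ⟨c, hc, hc0⟩ := Matrix.exists_vecMul_eq_zero_iff.mpr h0
  have h1 : toBilin ω (∑ i, c i • b i) = 0 := by
    refine b.ext fun j => ?_
    have := congrFun hc0 j
    simpa [Matrix.vecMul, dotProduct, toBilin_apply] using this
  have hu : ∑ i, c i • b i = 0 := by
    by_contra hne
    obtain ⟨y, hy⟩ := hω _ hne
    exact hy (by rw [← toBilin_apply, h1, LinearMap.zero_apply])
  exact hc (funext (Fintype.linearIndependent_iff.mp b.linearIndependent c hu))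

theorem dVolSymp_smul (c : ℝ) (ω : V [⋀^Fin 2]→ₗ[ℝ] ℝ) (n : ℕ) :
    dVolSymp n (c • ω) = c ^ n • dVolSymp n ω := by
  rw [dVolSymp, wedgePow_smul, dVolSymp, smul_comm]

/-- Swapping two basis vectors reverses the sign. For `n = 0` there is nothing to swap, hence the
separate hypothesis `h0`. -/
theorem exists_pos_basis {n : ℕ} {Λ : Submodule ℤ V} (α : V [⋀^Fin (2 * n)]→ₗ[ℝ] ℝ)
    (b : Module.Basis (Fin (2 * n)) ℤ Λ) (hb : α (fun i => (b i : V)) ≠ 0)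
    (h0 : n = 0 → 0 < α (fun i => (b i : V))) :
    ∃ b : Module.Basis (Fin (2 * n)) ℤ Λ, 0 < α (fun i => (b i : V)) := by
  rcases hb.lt_or_gt with h | h
  · rcases Nat.eq_zero_or_pos n with rfl | hn
    · exact absurd (h0 rfl) h.not_gt
    · let i : Fin (2 * n) := ⟨0, by omega⟩
      let j : Fin (2 * n) := ⟨1, by omega⟩
      have hij : i ≠ j := by simp [i, j]
      refine ⟨b.reindex (Equiv.swap i j), ?_⟩
      have := α.map_swap (fun i => (b i : V)) hij
      simp only [Module.Basis.reindex_apply, Equiv.symm_swap]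
      change 0 < α ((fun i => (b i : V)) ∘ Equiv.swap i j)
      rw [this]
      linarith
  · exact ⟨b, h⟩

end Lattice

/-! ### The Lagrangian subspace and the value of `Ω` on its lattice basis -/

section Lagrangian

open scoped InnerProductSpace

variable {E : Type*} [NormedAddCommGroup E] [InnerProductSpace ℂ E]
  {V : Type*} [NormedAddCommGroup V] [NormedSpace ℝ V] {n : ℕ} {Λ : Submodule ℤ V}
  {Φ : V ≃ₗ[ℝ] E} {A : Matrix (Fin n) (Fin n) ℝ} {v : Fin n → V}

/-- As `A` is real and invertible, `Φ` maps the span of `v` onto the real span of the unitary basis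
`e`, a copy of `ℝⁿ` in `ℂⁿ`. -/
theorem isLagrangian_span {ω : V [⋀^Fin 2]→ₗ[ℝ] ℝ}
    (hΦ : ∀ x y, (⟪Φ x, Φ y⟫_ℂ).im = ω ![x, y]) (e : OrthonormalBasis (Fin n) ℂ E)
    (hA : A.det ≠ 0) (hv : ∀ j, Φ (v j) = ∑ i, (A i j : ℂ) • e i) :
    IsLagrangian ω (Submodule.span ℝ (Set.range v)) := by
  have hAu : IsUnit A.det := isUnit_iff_ne_zero.mpr hA
  intro x
  constructor
  · intro hx y hy
    obtain ⟨a, rfl⟩ := (Submodule.mem_span_range_iff_exists_fun ℝ).mp hx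
    obtain ⟨b, rfl⟩ := (Submodule.mem_span_range_iff_exists_fun ℝ).mp hy
    rw [← hΦ, map_sum_smul_eq hv, map_sum_smul_eq hv, e.orthonormal.inner_sum, Complex.im_sum]
    exact Finset.sum_eq_zero fun i _ => by simp
  · intro h
    have him : ∀ i, (⟪e i, Φ x⟫_ℂ).im = 0 := by
      intro i
      have h1 := h (∑ j, A⁻¹ j i • v j) (Submodule.sum_mem _ fun j _ =>
        Submodule.smul_mem _ _ (Submodule.subset_span ⟨j, rfl⟩))
      have h2 : Φ (∑ j, A⁻¹ j i • v j) = e i := by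
        rw [map_sum_smul_eq hv fun j => A⁻¹ j i]
        have h3 : ∀ l, A.mulVec (fun j => A⁻¹ j i) l = (1 : Matrix (Fin n) (Fin n) ℝ) l i := by
          intro l
          rw [← Matrix.mul_nonsing_inv _ hAu]
          rfl
        simp [h3, Matrix.one_apply, ite_smul]
      rw [twoForm_swap, ← hΦ, h2] at h1
      linarith
    refine (Submodule.mem_span_range_iff_exists_fun ℝ).mpr
      ⟨A⁻¹.mulVec fun i => (⟪e i, Φ x⟫_ℂ).re, Φ.injective ?_⟩
    rw [map_sum_smul_eq hv, Matrix.mulVec_mulVec, Matrix.mul_nonsing_inv _ hAu,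
      Matrix.one_mulVec]
    refine Eq.trans ?_ (e.sum_repr' (Φ x))
    refine Finset.sum_congr rfl fun i _ => ?_
    congr 1
    apply Complex.ext
    · simp
    · simp [him]

theorem norm_smul_detForm_apply (c : ℂ) (e : OrthonormalBasis (Fin n) ℂ E)
    (hv : ∀ j, Φ (v j) = ∑ i, (A i j : ℂ) • e i) :
    ‖(c • detForm fun i => complexCoord (reCoord Φ e i) (imCoord Φ e i)) v‖ = ‖c‖ * |A.det| := by
  have h : (Matrix.of fun i j => complexCoord (reCoord Φ e j) (imCoord Φ e j) (v i)) =
      (A.map Complex.ofRealHom).transpose := by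
    ext i j
    simp only [Matrix.of_apply, complexCoord_apply, reCoord_apply, imCoord_apply]
    rw [mul_comm, Complex.re_add_im, hv, e.orthonormal.inner_right_fintype]
    simp
  rw [AlternatingMap.smul_apply, detForm_apply, h, Matrix.det_transpose, smul_eq_mul, norm_mul]
  have := Complex.ofRealHom.map_det A
  rw [RingHom.mapMatrix_apply] at this
  rw [← this]
  simp

end Lagrangian

end SympTorus

/-! ### The systolic inequality -/

open SympTorus in
theorem mainTheorem3 {V : Type*} [NormedAddCommGroup V] [NormedSpace ℝ V] [FiniteDimensional ℝ V]
    (n : ℕ) (hdim : Module.finrank ℝ V = 2 * n)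
    (Λ : Submodule ℤ V) [DiscreteTopology Λ] [IsZLattice ℝ Λ]
    (ω : V [⋀^Fin 2]→ₗ[ℝ] ℝ) (hω : SympTorus.IsSymplectic ω)
    (hrat : SympTorus.IsRationalOn ω Λ) :
    ∃ C : ℝ, 0 < C ∧ ∀ Ω ∈ SympTorus.geometricForms n ω,
      SympTorus.Sys ω Λ Ω ≠ ⊤ ∧
        (SympTorus.Sys ω Λ Ω).toReal ^ 2 ≤ C * SympTorus.Vol ω Λ Ω := by
  have hrank : Module.finrank ℤ Λ = 2 * n := by rw [ZLattice.rank ℝ Λ, hdim]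
  let b₀ : Module.Basis (Fin (2 * n)) ℤ Λ := Module.finBasisOfFinrankEq ℤ Λ hrank
  obtain ⟨N, hN, hint⟩ := exists_integral_multiple hrat b₀
  have hNR : (0 : ℝ) < N := by exact_mod_cast hN
  have hω' : IsSymplectic ((N : ℝ) • ω) := fun x hx => by
    obtain ⟨y, hy⟩ := hω x hx
    exact ⟨y, mul_ne_zero hNR.ne' hy⟩
  have key : ∀ Ω ∈ geometricForms n ω, ∃ Φ : V ≃ₗ[ℝ] EuclideanSpace ℂ (Fin n),
      (∀ x y, (inner ℂ (Φ x) (Φ y)).im = ((N : ℝ) • ω) ![x, y]) ∧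
      ∀ e : OrthonormalBasis (Fin n) ℂ (EuclideanSpace ℂ (Fin n)),
        ∃ c : ℂ, Ω = c • detForm fun i => complexCoord (reCoord Φ e i) (imCoord Φ e i) := by
    rintro Ω ⟨-, J, hJ, hΩ⟩
    have hJ' : IsCompatible ((N : ℝ) • ω) J :=
      ⟨hJ.sq, fun x y => congrArg (fun t => (N : ℝ) * t) (hJ.invariant x y),
        fun x hx => mul_pos hNR (hJ.pos x hx)⟩
    obtain ⟨Φ, hΦ, hΦJ⟩ := exists_unitary_equiv hdim hJ'
    exact ⟨Φ, hΦ, fun e => exists_eq_smul_detForm hΩ hΦJ e⟩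
  -- The nonvanishing of the symplectic volume is read off in the unitary coordinates of some `Ω₀`;
  -- if there is none, the claim is vacuous.
  rcases (geometricForms n ω).eq_empty_or_nonempty with hempty | ⟨Ω₀, hΩ₀⟩
  · exact ⟨1, one_pos, fun Ω hΩ => by simp [hempty] at hΩ⟩
  -- This excludes the default value `0` in `torusIntegral`.
  have hpos : ∃ b : Module.Basis (Fin (2 * n)) ℤ Λ, 0 < dVolSymp n ω (fun i => (b i : V)) := by
    obtain ⟨Φ, hΦ, -⟩ := key Ω₀ hΩ₀
    let e := EuclideanSpace.basisFun (Fin n) ℂ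
    have hli : LinearIndependent ℝ fun i => (b₀ i : V) := by
      have := (b₀.ofZLatticeBasis ℝ Λ).linearIndependent
      rwa [show ⇑(b₀.ofZLatticeBasis ℝ Λ) = fun i => (b₀ i : V) from
        funext fun i => b₀.ofZLatticeBasis_apply ℝ Λ i] at this
    refine exists_pos_basis _ b₀ (fun h0 => ?_) fun hn => ?_
    · refine detForm_interleave_coord_ne_zero Φ e hli ?_
      rw [← dVolSymp_eq (eq_sum_detForm_coord hΦ e), dVolSymp_smul, AlternatingMap.smul_apply, h0,
        smul_zero]
    · subst hn
      simp [dVolSymp, wedgePow]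
  set b := hpos.choose
  set δ := dVolSymp n ω (fun i => (b i : V))
  have hδ : 0 < δ := hpos.choose_spec
  set G : Matrix (Fin (2 * n)) (Fin (2 * n)) ℝ :=
    Matrix.of fun i j => ((N : ℝ) • ω) ![(b i : V), (b j : V)]
  have hG : G.det ≠ 0 := by
    have := det_gram_ne_zero hω' (b.ofZLatticeBasis ℝ Λ)
    simpa only [Module.Basis.ofZLatticeBasis_apply] using this
  -- Depends only on `Λ` and `ω`, and satisfies both `1 ≤ ρ` and `|det G| < ρ ^ 2`.
  set ρ : ℝ := |G.det| + 1
  have hρ1 : 1 ≤ ρ := by simp [ρ]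
  have hGρ : |G.det| < ρ ^ 2 := by
    have := abs_nonneg G.det
    simp only [ρ]
    nlinarith
  set R : ℝ := (2 * n * ρ) ^ n
  -- `R` bounds the covolume of the Lagrangian sublattice and `N ^ n * δ` is the torus volume for
  -- `Nω`; the `+ 1` only makes positivity immediate.
  refine ⟨(R ^ 2 + 1) / (N ^ n * δ), by positivity, fun Ω hΩ => ?_⟩
  obtain ⟨Φ, hΦ, hc⟩ := key Ω hΩ
  have hGΦ : (Matrix.of fun i j => (inner ℂ (Φ (b i : V)) (Φ (b j : V))).im) = G := by
    ext i j
    simp [G, hΦ]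
  obtain ⟨e', A, v, h, hdet⟩ := exists_isotropicBasis Λ Φ (finrank_euclideanSpace_fin) b
    (fun u hu w hw => by rw [hΦ]; exact hint u hu w hw) (by rwa [hGΦ]) ρ hρ1 (by rwa [hGΦ]) n le_rfl
  obtain ⟨e, rfl⟩ : ∃ e : OrthonormalBasis (Fin n) ℂ (EuclideanSpace ℂ (Fin n)), ⇑e = e' := by
    obtain ⟨e, he⟩ := Orthonormal.exists_orthonormalBasis_extension_of_card_eq (𝕜 := ℂ)
      (ι := Fin n) (by simp) (v := e') (s := Set.univ)
      (h.orthonormal.comp _ Subtype.val_injective)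
    exact ⟨e, funext fun i => he i trivial⟩
  obtain ⟨c, hcΩ⟩ := hc e
  have hlag' := isLagrangian_span hΦ e h.det_ne_zero h.expansion
  have hlag : IsLagrangian ω (Submodule.span ℝ (Set.range v)) := by
    intro x
    rw [hlag' x]
    refine forall₂_congr fun y _ => ?_
    simp [hNR.ne']
  have hnorm : ‖Ω v‖ = ‖c‖ * |A.det| := by
    rw [hcΩ]
    exact norm_smul_detForm_apply c e h.expansion
  -- Here the non-zero pullback of `Ω` to Lagrangian subspaces enters.
  have hc0 : c ≠ 0 := by
    rintro rfl
    refine hΩ.1.2 _ hlag ?_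
    rw [hcΩ, zero_smul]
    rfl
  have hΩv : Ω v ≠ 0 := by
    rw [← norm_ne_zero_iff, hnorm]
    exact mul_ne_zero (norm_ne_zero_iff.mpr hc0) (abs_ne_zero.mpr h.det_ne_zero)
  have hsys := Sys_le (linearIndependent_of_det_ne_zero Φ h.orthonormal h.det_ne_zero h.expansion)
    h.mem h.saturated hlag hΩv
  have hvol : Vol ω Λ Ω = ‖c‖ ^ 2 * (N ^ n * δ) := by
    rw [Vol, SympTorus.torusIntegral, dif_pos hpos]
    conv_lhs => rw [hcΩ]
    rw [dVolForm_eq, Complex.ofReal_re, ← dVolSymp_eq (eq_sum_detForm_coord hΦ e), dVolSymp_smul]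
    rfl
  refine ⟨ne_top_of_le_ne_top enorm_ne_top hsys, ?_⟩
  have hsys' : (Sys ω Λ Ω).toReal ≤ ‖c‖ * R := by
    calc (Sys ω Λ Ω).toReal ≤ ‖Ω v‖ := by
          have := ENNReal.toReal_mono enorm_ne_top hsys
          rwa [toReal_enorm] at this
      _ = ‖c‖ * |A.det| := hnorm
      _ ≤ ‖c‖ * R := mul_le_mul_of_nonneg_left hdet (norm_nonneg _)
  have hNδ : (0 : ℝ) < N ^ n * δ := by positivity
  calc (Sys ω Λ Ω).toReal ^ 2 ≤ (‖c‖ * R) ^ 2 := pow_le_pow_left₀ ENNReal.toReal_nonneg hsys' 2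
    _ ≤ (R ^ 2 + 1) * ‖c‖ ^ 2 := by nlinarith [sq_nonneg ‖c‖]
    _ = (R ^ 2 + 1) / (N ^ n * δ) * Vol ω Λ Ω := by
      rw [hvol]
      field_simp
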